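/- Let $\Theta\subseteq\mathbb{R}^d$ be open and $b\in\mathbb{R}$. For each $\theta\in\Theta$ let $X$ be a real random variable with probability density $f(\cdot;\theta)$. For $\alpha\in(0,1)$ let $q_\alpha(\theta)=\inf\{z:\Pr_\theta(X\le z)\ge\alpha\}$ be its $\alpha$-quantile, write $q(\theta)=q_{1/2}(\theta)$, and let $\mathrm{MMD}[X]=\mathbb{E}\big[|X-q(\theta)|\big]$ be the mean-median deviation. Here $\nabla_\theta=(\partial/\partial\theta_1,\dots,\partial/\partial\theta_d)$ is the vector of partial derivatives. Assume: 1. for every $\theta\in\Theta$, $X$ takes values in $[-b,b]$, and $f(\cdot;\theta)$ is continuous and bounded on $[-b,b]$ (and $0$ outside it); 2. for every $\alpha\in(0,1)$ and every $i$, $\partial q_\alpha(\theta)/\partial\theta_i$ exists for all $\theta\in\Theta$ and is bounded over $\theta\in\Theta$; 3. for every $i$, $\partial f(x;\theta)/\partial\theta_i$ exists for all $\theta\in\Theta$ and all $x$, and $\frac{\partial f(x;\theta)}{\partial\theta_i}/f(x;\theta)$ is bounded over all $\theta$ and $x$ (the quotient being read as $0$ where $f(x;\theta)=0$); 4. for every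 $\theta\in\Theta$, $f(q(\theta);\theta)>0$, and the conditional expectations $g_1(y;\theta)=\mathbb{E}\big[(2q(\theta)-X-b)\nabla_\theta\log f(X;\theta)\,\big|\,X=y\big]$ and $g_2(y;\theta)=\mathbb{E}\big[(b-X)\nabla_\theta\log f(X;\theta)\,\big|\,X=y\big]$ are continuous (have versions that are continuous) at $y=q(\theta)$. Fix $\theta\in\Theta$, let $x_1,x_2,\dots$ be i.i.d. with density $f(\cdot;\theta)$, let $\hat q=\inf\{z:\frac1n\sum_{i=1}^n\mathbb{I}_{x_i\le z}\ge\frac12\}$ be the empirical half quantile of $x_1,\dots,x_n$, and let $$\nabla_\theta\widehat{\mathrm{MMD}}[X]_{[n]}=\frac12\,\frac1{n/2}\sum_{i=1}^n(2\hat q-x_i-b)\,\nabla_\theta\log f(x_i;\theta)\,\mathbb{I}_{x_i\le\hat q}-\frac12\,\frac1{n/2}\sum_{i=1}^n(b-x_i)\,\nabla_\theta\log f(x_i;\theta)\,\mathbb{I}_{x_i\ge\hat q}.$$ Then $\nabla_\theta\mathrm{MMD}[X]$ exists, the estimator $\nabla_\theta\widehat{\mathrm{MMD}}[X]_{[n]}$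 is integrable for every $n$, and $$\mathbb{E}\big[\nabla_\theta\widehat{\mathrm{MMD}}[X]_{[n]}\big]-\nabla_\theta\mathrm{MMD}[X]=O(n^{-1/2})\qquad(n\to\infty).$$ -/

import Mathlib

open MeasureTheory ProbabilityTheory Filter Asymptotics

noncomputable section

namespace MMDGrad

/-- The parameter space `ℝ^d`. -/
abbrev Param (d : ℕ) : Type := EuclideanSpace ℝ (Fin d)

/-- The `i`-th coordinate direction. -/
def dir {d : ℕ} (i : Fin d) : Param d := EuclideanSpace.single i (1 : ℝ)

/-- `∂F/∂θ_i` exists at `θ`. -/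
def HasPartial {d : ℕ} (F : Param d → ℝ) (θ : Param d) (i : Fin d) : Prop :=
  LineDifferentiableAt ℝ F θ (dir i)

/-- The partial derivative `∂F/∂θ_i` at `θ`. -/
def partialDeriv {d : ℕ} (F : Param d → ℝ) (θ : Param d) (i : Fin d) : ℝ :=
  lineDeriv ℝ F θ (dir i)

/-- `∇_θ F`, the vector of the partial derivatives. -/
def grad {d : ℕ} (F : Param d → ℝ) (θ : Param d) : Param d :=
  WithLp.toLp 2 (fun i => partialDeriv F θ i)

/-- The law on `ℝ` with density `f(·; θ)`. -/
def law {d : ℕ} (f : Param d → ℝ → ℝ) (θ : Param d) : Measure ℝ :=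
  volume.withDensity (fun x => ENNReal.ofReal (f θ x))

/-- The `α`-quantile `inf {z | F(z) ≥ α}` of a law, `F` being its distribution function. -/
def quantile (μ : Measure ℝ) (α : ℝ) : ℝ :=
  sInf {z : ℝ | α ≤ μ.real (Set.Iic z)}

/-- The mean-median deviation `E|X - Median(X)|` of a random variable `X` with law `μ`. -/
def MMD (μ : Measure ℝ) : ℝ :=
  ∫ x, |x - quantile μ (1 / 2)| ∂μ

/-- The score `∇_θ log f(x; θ)`. -/
def score {d : ℕ} (f : Param d → ℝ → ℝ) (θ : Param d) (x : ℝ) : Param d :=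
  grad (fun θ' => Real.log (f θ' x)) θ

/-- `D₁(x; θ) = (2 q_{1/2}(X; θ) - x - b) ∇_θ log f(x; θ)`. -/
def D₁ {d : ℕ} (b : ℝ) (f : Param d → ℝ → ℝ) (θ : Param d) (x : ℝ) : Param d :=
  (2 * quantile (law f θ) (1 / 2) - x - b) • score f θ x

/-- `D₂(x; θ) = (b - x) ∇_θ log f(x; θ)`. -/
def D₂ {d : ℕ} (b : ℝ) (f : Param d → ℝ → ℝ) (θ : Param d) (x : ℝ) : Param d :=
  (b - x) • score f θ x

/-- `g` is a version of `y ↦ E[D(X) | X = y]`, where `X` has law `μ`: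
`E[g(X) ; X ∈ B] = E[D(X) ; X ∈ B]` for all Borel sets `B`. -/
def IsCondExpGivenValue {d : ℕ} (μ : Measure ℝ) (D g : ℝ → Param d) : Prop :=
  Integrable D μ ∧ Integrable g μ ∧
    ∀ B : Set ℝ, MeasurableSet B → ∫ y in B, g y ∂μ = ∫ y in B, D y ∂μ

/-- For every parameter, `f(·; θ)` is a probability density of a random variable with range in
`[-b, b]`, and it is continuous and bounded on that interval. -/
structure DensityAssumption {d : ℕ} (b : ℝ) (Θ : Set (Param d)) (f : Param d → ℝ → ℝ) :
    Prop where
  nonneg : ∀ θ ∈ Θ, ∀ x, 0 ≤ f θ x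
  eq_zero_of_notMem : ∀ θ ∈ Θ, ∀ x, x ∉ Set.Icc (-b) b → f θ x = 0
  continuousOn : ∀ θ ∈ Θ, ContinuousOn (f θ) (Set.Icc (-b) b)
  bounded : ∀ θ ∈ Θ, ∃ M : ℝ, ∀ x, f θ x ≤ M
  integral_eq_one : ∀ θ ∈ Θ, ∫ x, f θ x = 1

/-- For every level `α ∈ (0, 1)`, the partial derivatives of the quantile `q_α(X; θ)` exist and are
bounded over all parameters. -/
def QuantileAssumption {d : ℕ} (Θ : Set (Param d)) (f : Param d → ℝ → ℝ) : Prop :=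
  ∀ α ∈ Set.Ioo (0 : ℝ) 1, ∃ C : ℝ, ∀ θ ∈ Θ, ∀ i : Fin d,
    HasPartial (fun θ' => quantile (law f θ') α) θ i ∧
      |partialDeriv (fun θ' => quantile (law f θ') α) θ i| ≤ C

/-- `(∂f(x; θ)/∂θ_i) / f(x; θ)` exists and is bounded over all `θ` and `x`. Where `f(x; θ) = 0` the
quotient is read as `0`: there the nonnegative function `f(x; ·)` has a minimum, and its partial
derivatives vanish. -/
def ScoreAssumption {d : ℕ} (Θ : Set (Param d)) (f : Param d → ℝ → ℝ) : Prop :=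
  ∃ C : ℝ, ∀ θ ∈ Θ, ∀ x : ℝ, ∀ i : Fin d,
    HasPartial (fun θ' => f θ' x) θ i ∧ |partialDeriv (fun θ' => f θ' x) θ i / f θ x| ≤ C

/-- For every parameter, `g₁(y; θ) = E[D₁(X; θ) | X = y]` and `g₂(y; θ) = E[D₂(X; θ) | X = y]` are
continuous at the median (that is, have versions with this property), and the density is positive
there. -/
def MedianAssumption {d : ℕ} (b : ℝ) (Θ : Set (Param d)) (f : Param d → ℝ → ℝ) : Prop :=
  ∀ θ ∈ Θ,
    (∃ g₁ : ℝ → Param d, IsCondExpGivenValue (law f θ) (D₁ b f θ) g₁ ∧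
      ContinuousAt g₁ (quantile (law f θ) (1 / 2))) ∧
    (∃ g₂ : ℝ → Param d, IsCondExpGivenValue (law f θ) (D₂ b f θ) g₂ ∧
      ContinuousAt g₂ (quantile (law f θ) (1 / 2))) ∧
    0 < f θ (quantile (law f θ) (1 / 2))

/-- The empirical distribution function of a sample. -/
def empCDF {n : ℕ} (x : Fin n → ℝ) (z : ℝ) : ℝ :=
  (1 / (n : ℝ)) * ∑ i, if x i ≤ z then (1 : ℝ) else 0

/-- The empirical half quantile of a sample. -/
def empMedian {n : ℕ} (x : Fin n → ℝ) : ℝ :=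
  sInf {z : ℝ | 1 / 2 ≤ empCDF x z}

/-- The estimator of `∇_θ MMD[X]` from a sample of size `n`. -/
def gradEstimator {d : ℕ} (b : ℝ) (f : Param d → ℝ → ℝ) (θ : Param d) {n : ℕ} (x : Fin n → ℝ) :
    Param d :=
  ((1 / 2 : ℝ) * (1 / ((n : ℝ) / 2))) •
      (∑ i, if x i ≤ empMedian x then (2 * empMedian x - x i - b) • score f θ (x i) else 0)
    - ((1 / 2 : ℝ) * (1 / ((n : ℝ) / 2))) •
      (∑ i, if empMedian x ≤ x i then (b - x i) • score f θ (x i) else 0)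

end MMDGrad

end

/-! The proof identifies the gradient with an exact expectation, then measures the cost of replacing
the median `q` by the empirical median.

Gradient. A logarithmic derivative bounded by `C` gives, by Grönwall, `f(·; θ + t eᵢ) ≤ exp(C|t|)
f(·; θ)`, which dominates everything needed to differentiate under the integral. In `E|X - q(θ)|`
both density and centre move. Moving the density alone gives `∫ |x - q| ∂ᵢf`. Moving the centre
alone gives `2F(q) - 1 = 0`, and the cross term is `O(|t| |q(t) - q(0)|) = o(t)`. Since `∫ ∂ᵢf = 0`,
the weight `|x - q|` may be replaced by `|x - q| + (q - b)`, which is `2q - x - b` left of `q` and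
`-(b - x)` right of it. So the estimator with `q` in place of the empirical median is exactly
unbiased (`integral_splitSum_score_apply`).

Bias. Per observation, the replacement costs a multiple of `|q̂ - q|` plus a bounded amount if the
observation is separated from one of the two points (`norm_sum_splitSum_empMedian_sub_le`). Without
ties, the count at `q̂` is `n/2` up to 1, and the count at `q` is `n/2` up to `√n` in mean. The
distribution function crosses `1/2` linearly because the density is positive at `q`. Chebyshev then
gives `P(|q̂ - q| > t) ≲ 1/(n t²)` and, on integrating, `E|q̂ - q| = O(n^{-1/2})`. -/

noncomputable section

namespace MMDGrad

open Set Topology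

/-! ### Differentiation of integrals under a bounded logarithmic derivative -/

section

/-- A one-parameter family of nonnegative integrable functions on the line whose logarithmic
derivative in the parameter is bounded by `C` (read as `0` where the function vanishes). -/
structure LogLipschitzFamily (φ : ℝ → ℝ → ℝ) (r C : ℝ) : Prop where
  pos : 0 < r
  nonneg : ∀ t ∈ Ioo (-r) r, ∀ x, 0 ≤ φ t x
  differentiableAt : ∀ t ∈ Ioo (-r) r, ∀ x, DifferentiableAt ℝ (fun s => φ s x) t
  bound : ∀ t ∈ Ioo (-r) r, ∀ x, |deriv (fun s => φ s x) t / φ t x| ≤ C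
  measurable : ∀ t ∈ Ioo (-r) r, Measurable (φ t)
  integrable : ∀ t ∈ Ioo (-r) r, Integrable (φ t)

namespace LogLipschitzFamily

variable {φ : ℝ → ℝ → ℝ} {r C : ℝ}

theorem zero_mem (h : LogLipschitzFamily φ r C) : (0 : ℝ) ∈ Ioo (-r) r :=
  ⟨by linarith [h.pos], h.pos⟩

theorem nonneg_bound (h : LogLipschitzFamily φ r C) : 0 ≤ C :=
  (abs_nonneg _).trans (h.bound 0 h.zero_mem 0)

theorem abs_deriv_le (h : LogLipschitzFamily φ r C) {t : ℝ} (ht : t ∈ Ioo (-r) r) (x : ℝ) :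
    |deriv (fun s => φ s x) t| ≤ C * φ t x := by
  rcases (h.nonneg t ht x).eq_or_lt with h0 | h0
  -- A zero of a nonnegative function is a minimum, so the derivative vanishes there too, and
  -- reading `0 / 0` as `0` loses nothing.
  · have hmin : IsLocalMin (fun s => φ s x) t := by
      filter_upwards [isOpen_Ioo.mem_nhds ht] with s hs
      rw [← h0]
      exact h.nonneg s hs x
    rw [hmin.deriv_eq_zero, ← h0]
    simp
  · have := h.bound t ht x
    rwa [abs_div, abs_of_pos h0, div_le_iff₀ h0] at this

/-- Grönwall: `φ t x * exp (-C t)` decreases and `φ t x * exp (C t)` increases in `t`. In particular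
a zero of `φ 0` is a zero of every `φ t`. -/
theorem le_exp_mul (h : LogLipschitzFamily φ r C) {t : ℝ} (ht : t ∈ Ioo (-r) r) (x : ℝ) :
    φ t x ≤ Real.exp (C * |t|) * φ 0 x := by
  have hd : ∀ s ∈ Ioo (-r) r, ∀ c : ℝ, HasDerivAt (fun s => φ s x * Real.exp (c * s))
      ((deriv (fun s => φ s x) s + c * φ s x) * Real.exp (c * s)) s := by
    intro s hs c
    have h1 := (h.differentiableAt s hs x).hasDerivAt
    have h2 : HasDerivAt (fun s : ℝ => Real.exp (c * s)) (Real.exp (c * s) * c) s := by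
      simpa using ((hasDerivAt_id s).const_mul c).exp
    exact (h1.mul h2).congr_deriv (by ring)
  have hc : ∀ c : ℝ, ContinuousOn (fun s => φ s x * Real.exp (c * s)) (Ioo (-r) r) :=
    fun c s hs => (hd s hs c).continuousAt.continuousWithinAt
  have hdo : ∀ c : ℝ, DifferentiableOn ℝ (fun s => φ s x * Real.exp (c * s))
      (interior (Ioo (-r) r)) := fun c s hs =>
    (hd s (interior_subset hs) c).differentiableAt.differentiableWithinAt
  have hle := fun s (hs : s ∈ Ioo (-r) r) => abs_le.1 (h.abs_deriv_le hs x)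
  rcases le_total 0 t with h0 | h0
  · have hanti : AntitoneOn (fun s => φ s x * Real.exp (-C * s)) (Ioo (-r) r) := by
      refine antitoneOn_of_deriv_nonpos (convex_Ioo _ _) (hc _) (hdo _) fun s hs => ?_
      have hs := interior_subset hs
      rw [(hd s hs _).deriv]
      exact mul_nonpos_of_nonpos_of_nonneg (by linarith [(hle s hs).2]) (Real.exp_pos _).le
    have := hanti h.zero_mem ht h0
    simp only [mul_zero, Real.exp_zero, mul_one] at this
    rw [abs_of_nonneg h0]
    calc φ t x = Real.exp (C * t) * (φ t x * Real.exp (-C * t)) := by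
          rw [mul_left_comm, ← Real.exp_add]; simp
      _ ≤ _ := by gcongr
  · have hmono : MonotoneOn (fun s => φ s x * Real.exp (C * s)) (Ioo (-r) r) := by
      refine monotoneOn_of_deriv_nonneg (convex_Ioo _ _) (hc _) (hdo _) fun s hs => ?_
      have hs := interior_subset hs
      rw [(hd s hs _).deriv]
      exact mul_nonneg (by linarith [(hle s hs).1]) (Real.exp_pos _).le
    have := hmono ht h.zero_mem h0
    simp only [mul_zero, Real.exp_zero, mul_one] at this
    rw [abs_of_nonpos h0]
    calc φ t x = Real.exp (C * -t) * (φ t x * Real.exp (C * t)) := by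
          rw [mul_left_comm, ← Real.exp_add]; simp
      _ ≤ _ := by gcongr

theorem abs_deriv_le_exp_mul (h : LogLipschitzFamily φ r C) {t : ℝ} (ht : t ∈ Ioo (-r) r) (x : ℝ) :
    |deriv (fun s => φ s x) t| ≤ C * Real.exp (C * r) * φ 0 x := by
  have := h.nonneg_bound
  have h0 := h.nonneg 0 h.zero_mem x
  calc _ ≤ C * φ t x := h.abs_deriv_le ht x
    _ ≤ C * (Real.exp (C * |t|) * φ 0 x) := by gcongr; exact h.le_exp_mul ht x
    _ ≤ C * (Real.exp (C * r) * φ 0 x) := by gcongr; exact (abs_lt.2 ht).le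
    _ = _ := by ring

theorem abs_sub_le (h : LogLipschitzFamily φ r C) {t : ℝ} (ht : t ∈ Ioo (-r) r) (x : ℝ) :
    |φ t x - φ 0 x| ≤ C * Real.exp (C * r) * φ 0 x * |t| := by
  have := (convex_Ioo (-r) r).norm_image_sub_le_of_norm_deriv_le
    (fun s hs => h.differentiableAt s hs x) (fun s hs => h.abs_deriv_le_exp_mul hs x)
    h.zero_mem ht
  simpa using this

theorem measurable_deriv (h : LogLipschitzFamily φ r C) :
    Measurable (fun x => deriv (fun s => φ s x) 0) := by
  have hr := h.pos
  -- The derivative is a pointwise limit of measurable difference quotients; the `+ 2` keeps every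
  -- step strictly inside `(-r, r)`.
  have hlim : Tendsto (fun k : ℕ => r / ((k : ℝ) + 2)) atTop (𝓝[≠] 0) := by
    refine tendsto_nhdsWithin_iff.2 ⟨?_, Eventually.of_forall fun k => ?_⟩
    · exact Tendsto.const_div_atTop
        (tendsto_atTop_add_const_right _ _ tendsto_natCast_atTop_atTop) _
    · have : (0 : ℝ) < r / ((k : ℝ) + 2) := by positivity
      exact this.ne'
  have hmem : ∀ k : ℕ, r / ((k : ℝ) + 2) ∈ Ioo (-r) r := by
    intro k
    have h1 : (0 : ℝ) < r / ((k : ℝ) + 2) := by positivity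
    refine ⟨by linarith, div_lt_self hr ?_⟩
    have : (0 : ℝ) ≤ k := k.cast_nonneg
    linarith
  refine measurable_of_tendsto_metrizable
    (f := fun (k : ℕ) x => (r / ((k : ℝ) + 2))⁻¹ * (φ (r / ((k : ℝ) + 2)) x - φ 0 x))
    (fun k => ((h.measurable _ (hmem k)).sub (h.measurable 0 h.zero_mem)).const_mul _) ?_
  rw [tendsto_pi_nhds]
  intro x
  have := (h.differentiableAt 0 h.zero_mem x).hasDerivAt.tendsto_slope_zero.comp hlim
  simpa [Function.comp_def] using this

theorem hasDerivAt_integral_mul (h : LogLipschitzFamily φ r C) {w : ℝ → ℝ} (hw : Measurable w)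
    (hint : Integrable (fun x => w x * φ 0 x)) :
    Integrable (fun x => w x * deriv (fun s => φ s x) 0) ∧
      HasDerivAt (fun t => ∫ x, w x * φ t x) (∫ x, w x * deriv (fun s => φ s x) 0) 0 := by
  have hnhds := isOpen_Ioo.mem_nhds h.zero_mem
  refine hasDerivAt_integral_of_dominated_loc_of_deriv_le (s := Ioo (-r) r)
    (F' := fun t x => w x * deriv (fun s => φ s x) t)
    (bound := fun x => C * Real.exp (C * r) * |w x * φ 0 x|) hnhds ?_ hint ?_ ?_ ?_ ?_
  · filter_upwards [hnhds] with t ht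
    exact (hw.mul (h.measurable t ht)).aestronglyMeasurable
  · exact (hw.mul h.measurable_deriv).aestronglyMeasurable
  · refine Eventually.of_forall fun x t ht => ?_
    rw [Real.norm_eq_abs, abs_mul, abs_mul, abs_of_nonneg (h.nonneg 0 h.zero_mem x)]
    calc _ ≤ |w x| * (C * Real.exp (C * r) * φ 0 x) := by
          gcongr; exact h.abs_deriv_le_exp_mul ht x
      _ = _ := by ring
  · exact hint.abs.const_mul _
  · exact Eventually.of_forall fun x t ht =>
      ((h.differentiableAt t ht x).hasDerivAt).const_mul _

theorem integral_deriv_eq_zero (h : LogLipschitzFamily φ r C)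
    (hone : ∀ t ∈ Ioo (-r) r, ∫ x, φ t x = 1) : ∫ x, deriv (fun s => φ s x) 0 = 0 := by
  have h1 := (h.hasDerivAt_integral_mul (w := fun _ => 1) measurable_const
    (by simpa using h.integrable 0 h.zero_mem)).2
  simp only [one_mul] at h1
  have h2 : HasDerivAt (fun t => ∫ x, φ t x) 0 0 := by
    refine (hasDerivAt_const (0 : ℝ) (1 : ℝ)).congr_of_eventuallyEq ?_
    filter_upwards [isOpen_Ioo.mem_nhds h.zero_mem] with t ht using hone t ht
  exact h1.unique h2

end LogLipschitzFamily

theorem abs_abs_sub_sub_abs_sub_le (x a c : ℝ) : |(|x - a| - |x - c|)| ≤ |a - c| := by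
  calc _ ≤ |(x - a) - (x - c)| := abs_abs_sub_abs_le_abs_sub _ _
    _ = _ := by rw [abs_sub_comm]; congr 1; ring

/-- The derivative in `m` of `|x - m|` at `q` is `1` for `x < q` and `-1` for `x > q`, so the total
is twice the mass up to `q` minus the whole mass. The kink sits on a null set, and the Lipschitz
constant `|p x|` is the dominating function. -/
theorem hasDerivAt_integral_abs_sub_mul {p : ℝ → ℝ} (hp : Integrable p)
    (hp1 : Integrable (fun x => x * p x)) (q : ℝ)
    (hq : 2 * ∫ x in Iic q, p x = ∫ x, p x) :
    HasDerivAt (fun m => ∫ x, |x - m| * p x) 0 q := by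
  have hmeas : ∀ m, AEStronglyMeasurable (fun x => |x - m| * p x) volume := fun m =>
    ((continuous_id.sub continuous_const).abs.aestronglyMeasurable).mul hp.1
  have key := hasDerivAt_integral_of_dominated_loc_of_lip (μ := volume) (𝕜 := ℝ)
    (F := fun m x => |x - m| * p x) (x₀ := q) (s := univ) (bound := fun x => ‖p x‖)
    (F' := fun x => 2 * (Iic q).indicator p x - p x) univ_mem
    (Eventually.of_forall hmeas) ?_ ?_ ?_ hp.norm ?_
  · have h2 := key.2
    rwa [integral_sub ((hp.indicator measurableSet_Iic).const_mul _) hp, integral_const_mul,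
      integral_indicator measurableSet_Iic, hq, sub_self] at h2
  · refine (hp1.norm.add (hp.norm.const_mul |q|)).mono' (hmeas q) (Eventually.of_forall fun x => ?_)
    simp only [norm_mul, Real.norm_eq_abs, abs_abs, Pi.add_apply]
    calc |x - q| * |p x| ≤ (|x| + |q|) * |p x| := by gcongr; exact abs_sub x q
      _ = _ := by ring
  · exact (((hp.indicator measurableSet_Iic).const_mul _).sub hp).1
  · refine Eventually.of_forall fun x => LipschitzOnWith.of_dist_le_mul fun a _ c _ => ?_
    simp only [Real.dist_eq, ← sub_mul, abs_mul, Real.coe_nnabs, Real.norm_eq_abs, abs_abs]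
    rw [mul_comm]
    exact mul_le_mul_of_nonneg_left (abs_abs_sub_sub_abs_sub_le x a c) (abs_nonneg _)
  · have hne : ∀ᵐ x : ℝ, x ≠ q := by simp [ae_iff]
    filter_upwards [hne] with x hx
    rcases lt_or_gt_of_ne hx with hlt | hgt
    · have h1 : HasDerivAt (fun m => (m - x) * p x) (1 * p x) q :=
        ((hasDerivAt_id q).sub_const x).mul_const _
      simp only [indicator, mem_Iic, hlt.le, if_true]
      refine (h1.congr_of_eventuallyEq ?_).congr_deriv (by ring)
      filter_upwards [lt_mem_nhds hlt] with m hm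
      rw [abs_sub_comm, abs_of_pos (by linarith)]
    · have h1 : HasDerivAt (fun m => (x - m) * p x) (-1 * p x) q :=
        ((hasDerivAt_id q).const_sub x).mul_const _
      simp only [indicator, mem_Iic, hgt.not_ge, if_false]
      refine (h1.congr_of_eventuallyEq ?_).congr_deriv (by ring)
      filter_upwards [gt_mem_nhds hgt] with m hm
      rw [abs_of_pos (by linarith)]

theorem LogLipschitzFamily.hasDerivAt_integral_abs_sub {φ : ℝ → ℝ → ℝ} {r C : ℝ}
    (h : LogLipschitzFamily φ r C)
    (hmom : ∀ t ∈ Ioo (-r) r, Integrable (fun x => x * φ t x)) {q : ℝ → ℝ}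
    (hq : DifferentiableAt ℝ q 0) (hmed : 2 * ∫ x in Iic (q 0), φ 0 x = ∫ x, φ 0 x) :
    HasDerivAt (fun t => ∫ x, |x - q t| * φ t x)
      (∫ x, |x - q 0| * deriv (fun s => φ s x) 0) 0 := by
  have habs : ∀ t ∈ Ioo (-r) r, ∀ m, Integrable (fun x => |x - m| * φ t x) := by
    intro t ht m
    refine ((hmom t ht).norm.add ((h.integrable t ht).norm.const_mul |m|)).mono'
      (((continuous_id.sub continuous_const).abs.aestronglyMeasurable).mul (h.integrable t ht).1)
      (Eventually.of_forall fun x => ?_)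
    simp only [norm_mul, Real.norm_eq_abs, abs_abs, Pi.add_apply]
    calc |x - m| * |φ t x| ≤ (|x| + |m|) * |φ t x| := by gcongr; exact abs_sub x m
      _ = _ := by ring
  have h0 := h.zero_mem
  have hA := (h.hasDerivAt_integral_mul (w := fun x => |x - q 0|) (by fun_prop) (habs 0 h0 _)).2
  have hG := (hasDerivAt_integral_abs_sub_mul (h.integrable 0 h0) (hmom 0 h0) _ hmed).comp
    (0 : ℝ) hq.hasDerivAt
  rw [zero_mul] at hG
  set K := C * Real.exp (C * r) * ∫ x, φ 0 x with hK
  -- The cross term: what remains of the increment after changing only the density and only the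
  -- centre. It is a product of two small factors, hence `o(t)`.
  set R : ℝ → ℝ := fun t => ∫ x, (|x - q t| - |x - q 0|) * (φ t x - φ 0 x) with hR
  have hRle : ∀ t ∈ Ioo (-r) r, |R t| ≤ K * (|q t - q 0| * |t|) := by
    intro t ht
    have hb : ∀ x, ‖(|x - q t| - |x - q 0|) * (φ t x - φ 0 x)‖ ≤
        |q t - q 0| * (C * Real.exp (C * r) * |t|) * φ 0 x := by
      intro x
      rw [norm_mul, Real.norm_eq_abs, Real.norm_eq_abs]
      calc _ ≤ |q t - q 0| * (C * Real.exp (C * r) * φ 0 x * |t|) :=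
            mul_le_mul (abs_abs_sub_sub_abs_sub_le x _ _) (h.abs_sub_le ht x) (abs_nonneg _)
              (abs_nonneg _)
        _ = _ := by ring
    have := norm_integral_le_of_norm_le ((h.integrable 0 h0).const_mul _)
      (Eventually.of_forall hb)
    rw [integral_const_mul, Real.norm_eq_abs] at this
    refine this.trans_eq ?_
    rw [hK]; ring
  have hRd : HasDerivAt R 0 0 := by
    have hR0 : R 0 = 0 := by simp [hR]
    rw [hasDerivAt_iff_isLittleO]
    simp only [hR0, sub_zero, smul_zero]
    have hO : R =O[𝓝 0] fun t => (q t - q 0) * t := by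
      refine IsBigO.of_bound K ?_
      filter_upwards [isOpen_Ioo.mem_nhds h0] with t ht
      simpa [abs_mul] using hRle t ht
    refine hO.trans_isLittleO ?_
    have hq0 : (fun t => q t - q 0) =o[𝓝 0] (fun _ => (1 : ℝ)) := by
      rw [isLittleO_one_iff]
      simpa using hq.continuousAt.tendsto.sub_const (q 0)
    simpa using hq0.mul_isBigO (isBigO_refl (fun t : ℝ => t) (𝓝 0))
  have hsum := (hA.add hG).add hRd
  rw [add_zero, add_zero] at hsum
  refine (hsum.sub_const (∫ x, |x - q 0| * φ 0 x)).congr_of_eventuallyEq ?_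
  filter_upwards [isOpen_Ioo.mem_nhds h0] with t ht
  have i1 := habs t ht (q t)
  have i2 := habs t ht (q 0)
  have i3 := habs 0 h0 (q t)
  have i4 := habs 0 h0 (q 0)
  have : R t = (∫ x, |x - q t| * φ t x) - (∫ x, |x - q 0| * φ t x) -
      ((∫ x, |x - q t| * φ 0 x) - ∫ x, |x - q 0| * φ 0 x) := by
    rw [← integral_sub i1 i2, ← integral_sub i3 i4, 
      ← integral_sub (by exact i1.sub i2) (by exact i3.sub i4)]
    exact integral_congr_ae (Eventually.of_forall fun x => by simp; ring)
  simp only [Pi.add_apply, Function.comp_apply]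
  rw [this]; ring

end

/-! ### The law, its median, and the score -/

section

namespace DensityAssumption

variable {d : ℕ} {b : ℝ} {Θ : Set (Param d)} {f : Param d → ℝ → ℝ} {θ : Param d}

theorem measurable (h : DensityAssumption b Θ f) (hθ : θ ∈ Θ) : Measurable (f θ) := by
  have : f θ = (Icc (-b) b).piecewise (f θ) (fun _ => 0) := by
    ext x
    by_cases hx : x ∈ Icc (-b) b
    · simp [Set.piecewise, hx]
    · rw [Set.piecewise_eq_of_notMem _ _ _ hx, h.eq_zero_of_notMem θ hθ x hx]
  rw [this]
  exact (h.continuousOn θ hθ).measurable_piecewise continuousOn_const measurableSet_Icc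

theorem integrable (h : DensityAssumption b Θ f) (hθ : θ ∈ Θ) : Integrable (f θ) := by
  by_contra hn
  have := h.integral_eq_one θ hθ
  rw [integral_undef hn] at this
  exact zero_ne_one this

theorem isProbabilityMeasure_law (h : DensityAssumption b Θ f) (hθ : θ ∈ Θ) :
    IsProbabilityMeasure (law f θ) := by
  constructor
  rw [law, withDensity_apply _ MeasurableSet.univ, Measure.restrict_univ,
    ← ofReal_integral_eq_lintegral_ofReal (h.integrable hθ)
      (Eventually.of_forall (h.nonneg θ hθ)), h.integral_eq_one θ hθ, ENNReal.ofReal_one]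

theorem law_ac : law f θ ≪ volume := withDensity_absolutelyContinuous _ _

theorem law_singleton (x : ℝ) : law f θ {x} = 0 := law_ac (by simp)

theorem integral_law (h : DensityAssumption b Θ f) (hθ : θ ∈ Θ) (g : ℝ → ℝ) :
    ∫ x, g x ∂(law f θ) = ∫ x, g x * f θ x := by
  rw [law, integral_withDensity_eq_integral_toReal_smul (h.measurable hθ).ennreal_ofReal
    (Eventually.of_forall fun x => ENNReal.ofReal_lt_top)]
  refine integral_congr_ae (Eventually.of_forall fun x => ?_)
  simp [ENNReal.toReal_ofReal (h.nonneg θ hθ x), mul_comm]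

theorem law_real (h : DensityAssumption b Θ f) (hθ : θ ∈ Θ) {s : Set ℝ} (hs : MeasurableSet s) :
    (law f θ).real s = ∫ x in s, f θ x := by
  have := h.isProbabilityMeasure_law hθ
  rw [← integral_indicator_one hs, h.integral_law hθ, ← integral_indicator hs]
  refine integral_congr_ae (Eventually.of_forall fun x => ?_)
  by_cases hx : x ∈ s <;> simp [hx]

theorem law_compl_Icc (h : DensityAssumption b Θ f) (hθ : θ ∈ Θ) : law f θ (Icc (-b) b)ᶜ = 0 := by
  have := h.isProbabilityMeasure_law hθ
  rw [← measureReal_eq_zero_iff, h.law_real hθ measurableSet_Icc.compl]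
  exact setIntegral_eq_zero_of_forall_eq_zero fun x hx => h.eq_zero_of_notMem θ hθ x hx

theorem ae_mem_Icc (h : DensityAssumption b Θ f) (hθ : θ ∈ Θ) :
    ∀ᵐ x ∂(law f θ), x ∈ Icc (-b) b := h.law_compl_Icc hθ

theorem law_real_Iic_left (h : DensityAssumption b Θ f) (hθ : θ ∈ Θ) {z : ℝ} (hz : z ≤ -b) :
    (law f θ).real (Iic z) = 0 := by
  have := h.isProbabilityMeasure_law hθ
  rw [measureReal_eq_zero_iff]
  refine measure_mono_null (t := (Icc (-b) b)ᶜ ∪ {-b}) (fun x hx => ?_)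
    (measure_union_null (h.law_compl_Icc hθ) (law_singleton _))
  rcases (hx.trans hz : x ≤ -b).eq_or_lt with h' | h'
  · exact Or.inr h'
  · exact Or.inl fun h2 => h'.not_ge h2.1

theorem law_real_Iic_right (h : DensityAssumption b Θ f) (hθ : θ ∈ Θ) {z : ℝ} (hz : b ≤ z) :
    (law f θ).real (Iic z) = 1 := by
  have := h.isProbabilityMeasure_law hθ
  have h1 : ∀ᵐ x ∂(law f θ), x ∈ Iic z := by
    filter_upwards [h.ae_mem_Icc hθ] with x hx using hx.2.trans hz
  rw [measureReal_def, (mem_ae_iff_prob_eq_one measurableSet_Iic).1 h1, ENNReal.toReal_one]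

theorem continuous_law_real_Iic (h : DensityAssumption b Θ f) (hθ : θ ∈ Θ) :
    Continuous fun z => (law f θ).real (Iic z) := by
  have hi := h.integrable hθ
  have : (fun z => (law f θ).real (Iic z)) =
      fun z => (∫ x in Iic 0, f θ x) + ∫ x in (0 : ℝ)..z, f θ x := by
    ext z
    rw [h.law_real hθ measurableSet_Iic, ← intervalIntegral.integral_Iic_sub_Iic
      hi.integrableOn hi.integrableOn]
    ring
  rw [this]
  exact continuous_const.add (hi.continuous_primitive 0)

/-- The distribution function is continuous: the infimum is attained, giving `≥`, and values to its
left are below `1 / 2`, giving `≤` in the limit. -/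
theorem law_real_Iic_quantile (h : DensityAssumption b Θ f) (hθ : θ ∈ Θ) :
    (law f θ).real (Iic (quantile (law f θ) (1 / 2))) = 1 / 2 := by
  have hc := h.continuous_law_real_Iic hθ
  set F := fun z => (law f θ).real (Iic z) with hF
  set S := {z : ℝ | 1 / 2 ≤ F z} with hS
  have hne : S.Nonempty := ⟨b, by
    simp only [hS, mem_ofPred_eq, hF, h.law_real_Iic_right hθ le_rfl]; norm_num⟩
  have hbdd : BddBelow S := ⟨-b, fun z hz => by
    by_contra hlt
    have : F z = 0 := h.law_real_Iic_left hθ (not_le.1 hlt).le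
    simp only [hS, mem_ofPred_eq, this] at hz
    norm_num at hz⟩
  have hcl : IsClosed S := isClosed_le continuous_const hc
  have hmem : 1 / 2 ≤ F (sInf S) := hcl.csInf_mem hne hbdd
  refine le_antisymm ?_ hmem
  refine le_of_tendsto (hc.continuousWithinAt (s := Iio (sInf S)) (x := sInf S))  ?_
  filter_upwards [self_mem_nhdsWithin] with z hz
  by_contra hlt
  exact (csInf_le hbdd (not_le.1 hlt).le).not_gt hz

theorem quantile_mem_Ioo (h : DensityAssumption b Θ f) (hθ : θ ∈ Θ) :
    quantile (law f θ) (1 / 2) ∈ Ioo (-b) b := by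
  have hq := h.law_real_Iic_quantile hθ
  constructor
  · by_contra hn
    rw [h.law_real_Iic_left hθ (not_lt.1 hn)] at hq
    norm_num at hq
  · by_contra hn
    rw [h.law_real_Iic_right hθ (not_lt.1 hn)] at hq
    norm_num at hq

theorem pos (h : DensityAssumption b Θ f) (hθ : θ ∈ Θ) : 0 < b := by
  have := h.quantile_mem_Ioo hθ
  linarith [this.1, this.2]

theorem mul_sub_le_law_real_Iic_sub (h : DensityAssumption b Θ f) (hθ : θ ∈ Θ) {m x y : ℝ}
    (hxy : x ≤ y) (hm : ∀ z ∈ Ioc x y, m ≤ f θ z) :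
    m * (y - x) ≤ (law f θ).real (Iic y) - (law f θ).real (Iic x) := by
  have hi := h.integrable hθ
  rw [h.law_real hθ measurableSet_Iic, h.law_real hθ measurableSet_Iic,
    intervalIntegral.integral_Iic_sub_Iic hi.integrableOn hi.integrableOn,
    intervalIntegral.integral_of_le hxy]
  calc m * (y - x) = ∫ _ in Ioc x y, m := by simp [hxy, mul_comm]
    _ ≤ _ := setIntegral_mono_on (by simp) hi.integrableOn measurableSet_Ioc hm

/-- A positive continuous density at the median makes the distribution function cross the level
`1 / 2` at a linear rate. -/
theorem exists_linear_growth (h : DensityAssumption b Θ f) (hθ : θ ∈ Θ)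
    (hpos : 0 < f θ (quantile (law f θ) (1 / 2))) :
    ∃ c > 0, ∀ t ∈ Icc 0 (2 * b),
      c * t ≤ (law f θ).real (Iic (quantile (law f θ) (1 / 2) + t)) - 1 / 2 ∧
      c * t ≤ 1 / 2 - (law f θ).real (Iic (quantile (law f θ) (1 / 2) - t)) := by
  have := h.isProbabilityMeasure_law hθ
  have hq := h.law_real_Iic_quantile hθ
  have hqm := h.quantile_mem_Ioo hθ
  have hb := h.pos hθ
  set q := quantile (law f θ) (1 / 2)
  set m := f θ q / 2 with hm
  have hm0 : 0 < m := by positivity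
  have hcont : ContinuousAt (f θ) q :=
    (h.continuousOn θ hθ).continuousAt (Icc_mem_nhds hqm.1 hqm.2)
  obtain ⟨ε, hε, hball⟩ := Metric.eventually_nhds_iff.1
    (hcont.eventually (lt_mem_nhds (show m < f θ q by linarith)))
  have hlow : ∀ z, |z - q| ≤ ε / 2 → m ≤ f θ z := fun z hz =>
    (hball (by rw [Real.dist_eq]; linarith)).le
  -- The density vanishes off `[-b, b]`, so an interval on which it is at least `m > 0` lies inside;
  -- this yields `δ ≤ 2 * b`.
  have hsupp : ∀ z, |z - q| ≤ ε / 2 → z ∈ Icc (-b) b := fun z hz => by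
    by_contra hn
    have h1 := hlow z hz
    rw [h.eq_zero_of_notMem θ hθ z hn] at h1
    linarith
  set δ := ε / 2 with hδ
  have hδ0 : 0 < δ := by positivity
  have hδb : δ ≤ 2 * b := by
    have h1 := (hsupp (q + δ) (by rw [add_sub_cancel_left, abs_of_pos hδ0])).2
    have h2 := (hsupp (q - δ) (by rw [sub_sub_cancel_left, abs_neg, abs_of_pos hδ0])).1
    linarith
  have hmono : Monotone fun z => (law f θ).real (Iic z) := fun x y hxy =>
    measureReal_mono (Iic_subset_Iic.2 hxy)
  -- Slope `m` works up to distance `δ`; beyond it only monotonicity is left. Shrinking the slope by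
  -- `δ / (2 * b)` keeps the line below `m * min t δ` on all of `[0, 2b]`.
  refine ⟨m * δ / (2 * b), by positivity, fun t ht => ?_⟩
  have hmin : m * δ / (2 * b) * t ≤ m * min t δ := by
    have : δ / (2 * b) * t ≤ min t δ := by
      refine le_min ?_ ?_
      · exact mul_le_of_le_one_left ht.1 ((div_le_one (by positivity)).2 hδb)
      · rw [div_mul_eq_mul_div, div_le_iff₀ (by positivity)]
        exact mul_le_mul_of_nonneg_left ht.2 hδ0.le
    calc _ = m * (δ / (2 * b) * t) := by ring
      _ ≤ _ := by gcongr
  have hmn : 0 ≤ min t δ := le_min ht.1 hδ0.le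
  have hδm := min_le_right t δ
  constructor
  · have h1 := h.mul_sub_le_law_real_Iic_sub hθ (m := m) (x := q) (y := q + min t δ)
      (by linarith) (fun z hz => hlow z (abs_le.2 ⟨by linarith [hz.1], by linarith [hz.2]⟩))
    have h2 := hmono (show q + min t δ ≤ q + t by linarith [min_le_left t δ])
    simp only [hq, add_sub_cancel_left] at h1 h2
    linarith
  · have h1 := h.mul_sub_le_law_real_Iic_sub hθ (m := m) (x := q - min t δ) (y := q)
      (by linarith) (fun z hz => hlow z (abs_le.2 ⟨by linarith [hz.1], by linarith [hz.2]⟩))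
    have h2 := hmono (show q - t ≤ q - min t δ by linarith [min_le_left t δ])
    simp only [hq, sub_sub_cancel] at h1 h2
    linarith

theorem exists_logLipschitzFamily (h : DensityAssumption b Θ f) (hΘ : IsOpen Θ)
    {C : ℝ} (hC : ∀ θ ∈ Θ, ∀ x : ℝ, ∀ i : Fin d,
      HasPartial (fun θ' => f θ' x) θ i ∧ |partialDeriv (fun θ' => f θ' x) θ i / f θ x| ≤ C)
    (hθ : θ ∈ Θ) (i : Fin d) :
    ∃ r, (∀ t ∈ Ioo (-r) r, θ + t • dir i ∈ Θ) ∧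
      LogLipschitzFamily (fun t => f (θ + t • dir i)) r C := by
  have hcont : ContinuousAt (fun t : ℝ => θ + t • dir i) 0 := by fun_prop
  have hev := hcont.eventually (hΘ.mem_nhds (by simpa using hθ))
  obtain ⟨r, hr, hball⟩ := Metric.eventually_nhds_iff.1 hev
  have hmem : ∀ t ∈ Ioo (-r) r, θ + t • dir i ∈ Θ := fun t ht =>
    hball (by rw [Real.dist_eq, sub_zero]; exact abs_lt.2 ht)
  -- A partial derivative at `θ + t eᵢ` is a derivative at `0` along a line based there; moving the
  -- base point makes it a derivative at `t`.
  have hshift : ∀ t x, (fun s : ℝ => f (θ + t • dir i + s • dir i) x) =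
      fun s => f (θ + (t + s) • dir i) x := fun t x => by
    ext s; rw [add_smul, add_assoc]
  refine ⟨r, hmem, hr, fun t ht x => h.nonneg _ (hmem t ht) x, fun t ht x => ?_, fun t ht x => ?_,
    fun t ht => h.measurable (hmem t ht), fun t ht => h.integrable (hmem t ht)⟩
  · have h1 := (hC _ (hmem t ht) x i).1
    rw [HasPartial, LineDifferentiableAt, hshift] at h1
    have h2 : DifferentiableAt ℝ (fun s => f (θ + (t + (s - t)) • dir i) x) t :=
      DifferentiableAt.comp t (g := fun s : ℝ => f (θ + (t + s) • dir i) x) (f := fun s => s - t)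
        (by simpa using h1) (by fun_prop)
    simpa using h2
  · have h1 := (hC _ (hmem t ht) x i).2
    rw [partialDeriv, lineDeriv, hshift, deriv_comp_const_add (f := fun s => f (θ + s • dir i) x)] at h1
    simpa using h1

end DensityAssumption

variable {d : ℕ} {f : Param d → ℝ → ℝ} {θ : Param d} {r C : ℝ} {i : Fin d}

/-- Where the density vanishes at `θ`, `le_exp_mul` makes it vanish along the whole segment, so its
logarithm is constantly `Real.log 0 = 0`, in agreement with division by zero on the right. -/
theorem score_apply (h : LogLipschitzFamily (fun t => f (θ + t • dir i)) r C) (x : ℝ) :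
    score f θ x i = deriv (fun t : ℝ => f (θ + t • dir i) x) 0 / f θ x := by
  have hs : score f θ x i = deriv (fun t : ℝ => Real.log (f (θ + t • dir i) x)) 0 := rfl
  rw [hs]
  by_cases h0 : f θ x = 0
  · have : (fun t : ℝ => Real.log (f (θ + t • dir i) x)) =ᶠ[𝓝 0] fun _ => 0 := by
      filter_upwards [isOpen_Ioo.mem_nhds h.zero_mem] with t ht
      have h1 := h.le_exp_mul ht x
      simp only [zero_smul, add_zero, h0, mul_zero] at h1
      rw [le_antisymm h1 (h.nonneg t ht x), Real.log_zero]
    rw [this.deriv_eq, h0]; simp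
  · have := ((h.differentiableAt 0 h.zero_mem x).hasDerivAt.log (by simpa using h0)).deriv
    simpa using this

theorem score_mul_density (h : LogLipschitzFamily (fun t => f (θ + t • dir i)) r C) (x : ℝ) :
    score f θ x i * f θ x = deriv (fun t : ℝ => f (θ + t • dir i) x) 0 := by
  rw [score_apply h]
  by_cases h0 : f θ x = 0
  · have := h.abs_deriv_le h.zero_mem x
    simp only [zero_smul, add_zero, h0, mul_zero] at this
    rw [h0, mul_zero, abs_nonpos_iff.1 this]
  · exact div_mul_cancel₀ _ h0

theorem abs_score_apply_le (h : LogLipschitzFamily (fun t => f (θ + t • dir i)) r C) (x : ℝ) :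
    |score f θ x i| ≤ C := by
  rw [score_apply h]
  simpa using h.bound 0 h.zero_mem x

theorem measurable_score_apply (h : LogLipschitzFamily (fun t => f (θ + t • dir i)) r C) :
    Measurable fun x => score f θ x i := by
  have h1 := h.measurable 0 h.zero_mem
  simp only [zero_smul, add_zero] at h1
  simp_rw [score_apply h]
  exact h.measurable_deriv.div h1

theorem measurable_score (h : ∀ i, ∃ r, LogLipschitzFamily (fun t => f (θ + t • dir i)) r C) :
    Measurable (score f θ) := by
  have h1 : Measurable fun x => WithLp.toLp 2 (fun i => score f θ x i) :=
    (WithLp.measurable_toLp 2 _).comp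
      (measurable_pi_lambda _ fun i => measurable_score_apply (h i).choose_spec)
  exact h1

theorem norm_score_le (h : ∀ i, ∃ r, LogLipschitzFamily (fun t => f (θ + t • dir i)) r C) (x : ℝ) :
    ‖score f θ x‖ ≤ √(d * C ^ 2) := by
  rw [EuclideanSpace.norm_eq]
  refine Real.sqrt_le_sqrt ?_
  calc _ ≤ ∑ _i : Fin d, C ^ 2 := Finset.sum_le_sum fun i _ => by
        have := abs_score_apply_le (h i).choose_spec x
        rw [Real.norm_eq_abs]
        gcongr
    _ = _ := by simp

end

/-! ### Deterministic estimates for the empirical median and the estimator -/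

section

/-- The number of observations that are at most `z`. -/
def countLE {n : ℕ} (x : Fin n → ℝ) (z : ℝ) : ℝ := ∑ i, if x i ≤ z then (1 : ℝ) else 0

variable {n : ℕ} {x : Fin n → ℝ} {z a c b : ℝ}

theorem monotone_countLE (x : Fin n → ℝ) : Monotone (countLE x) := fun a c hac =>
  Finset.sum_le_sum fun i _ => by
    split_ifs with h1 h2 <;> first | exact absurd (h1.trans hac) h2 | norm_num

theorem half_le_empCDF_iff (hn : 0 < n) : 1 / 2 ≤ empCDF x z ↔ (n : ℝ) / 2 ≤ countLE x z := by
  have : (0 : ℝ) < n := by exact_mod_cast hn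
  rw [empCDF, countLE, one_div_mul_eq_div, le_div_iff₀ this]
  ring_nf

theorem countLE_eq_card (h : ∀ i, x i ≤ z) : countLE x z = n := by
  simp [countLE, h]

theorem countLE_eq_zero (h : ∀ i, z < x i) : countLE x z = 0 := by
  simp [countLE, fun i => (h i).not_ge]

theorem countLE_eventually_right (x : Fin n → ℝ) (z : ℝ) :
    ∀ᶠ y in 𝓝[≥] z, countLE x y = countLE x z := by
  have : ∀ᶠ y in 𝓝[≥] z, ∀ i, x i ≤ y ↔ x i ≤ z := by
    refine eventually_all.2 fun i => ?_
    by_cases h : x i ≤ z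
    · filter_upwards [self_mem_nhdsWithin] with y hy
      exact ⟨fun _ => h, fun _ => h.trans hy⟩
    · filter_upwards [mem_nhdsWithin_of_mem_nhds (gt_mem_nhds (not_le.1 h))] with y hy
      exact ⟨fun h' => absurd h' hy.not_ge, fun h' => absurd h' h⟩
  filter_upwards [this] with y hy
  simp [countLE, hy]

theorem countLE_eventually_left (x : Fin n → ℝ) (z : ℝ) :
    ∀ᶠ y in 𝓝[<] z, countLE x y = ∑ i, if x i < z then (1 : ℝ) else 0 := by
  have : ∀ᶠ y in 𝓝[<] z, ∀ i, x i ≤ y ↔ x i < z := by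
    refine eventually_all.2 fun i => ?_
    by_cases h : x i < z
    · filter_upwards [mem_nhdsWithin_of_mem_nhds (lt_mem_nhds h)] with y hy
      exact ⟨fun _ => h, fun _ => le_of_lt hy⟩
    · filter_upwards [self_mem_nhdsWithin] with y hy
      exact ⟨fun h' => h'.trans_lt hy, fun h' => absurd h' h⟩
  filter_upwards [this] with y hy
  simp [countLE, hy]

/-- The count is constant just to the right of each point, so the infimum is attained. This converts
every statement on the empirical median into one on counts. -/
theorem empMedian_le_iff (hn : 0 < n) : empMedian x ≤ z ↔ (n : ℝ) / 2 ≤ countLE x z := by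
  have hn' : (0 : ℝ) < n := by exact_mod_cast hn
  have hset : {z : ℝ | 1 / 2 ≤ empCDF x z} = {z : ℝ | (n : ℝ) / 2 ≤ countLE x z} :=
    Set.ext fun z => half_le_empCDF_iff hn
  rw [empMedian, hset]
  set S := {z : ℝ | (n : ℝ) / 2 ≤ countLE x z} with hS
  have hne : S.Nonempty := by
    obtain ⟨u, hu⟩ := (finite_range x).bddAbove
    refine ⟨u, ?_⟩
    rw [hS, mem_ofPred_eq, countLE_eq_card fun i => hu (mem_range_self i)]
    linarith
  have hbdd : BddBelow S := by
    obtain ⟨l, hl⟩ := (finite_range x).bddBelow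
    refine ⟨l, fun z hz => ?_⟩
    by_contra hlt
    rw [hS, mem_ofPred_eq, countLE_eq_zero fun i =>
      (not_le.1 hlt).trans_le (hl (mem_range_self i))] at hz
    linarith
  have hmem : (n : ℝ) / 2 ≤ countLE x (sInf S) := by
    obtain ⟨u, hu, hI⟩ := (mem_nhdsGE_iff_exists_Ico_subset).1 (countLE_eventually_right x (sInf S))
    obtain ⟨y, hy, hyu⟩ := exists_lt_of_csInf_lt hne hu
    have := hI ⟨csInf_le hbdd hy, hyu⟩
    exact (show (n : ℝ) / 2 ≤ countLE x y from hy).trans_eq this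
  exact ⟨fun h => hmem.trans (monotone_countLE x h), fun h => csInf_le hbdd h⟩

theorem half_le_countLE_empMedian (hn : 0 < n) : (n : ℝ) / 2 ≤ countLE x (empMedian x) :=
  (empMedian_le_iff hn).1 le_rfl

theorem sum_ite_eq_le_one (hx : Function.Injective x) (z : ℝ) :
    ∑ i, (if x i = z then (1 : ℝ) else 0) ≤ 1 := by
  rw [Finset.sum_boole]
  have : (Finset.univ.filter fun i => x i = z).card ≤ 1 := Finset.card_le_one.2 fun i hi j hj =>
    hx ((Finset.mem_filter.1 hi).2.trans (Finset.mem_filter.1 hj).2.symm)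
  exact_mod_cast this

/-- Strictly below the empirical median there are fewer than `n / 2` observations, and without ties
at most one sits on it. -/
theorem countLE_empMedian_le (hn : 0 < n) (hx : Function.Injective x) :
    countLE x (empMedian x) ≤ n / 2 + 1 := by
  set m := empMedian x with hm
  obtain ⟨y, hy, hym⟩ := ((countLE_eventually_left x m).and self_mem_nhdsWithin).exists
  have h1 : countLE x y < n / 2 := by
    by_contra h
    exact ((empMedian_le_iff hn).2 (not_lt.1 h)).not_gt hym
  have h2 : countLE x m = (∑ i, if x i < m then (1 : ℝ) else 0) +
      ∑ i, if x i = m then (1 : ℝ) else 0 := by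
    rw [countLE, ← Finset.sum_add_distrib]
    refine Finset.sum_congr rfl fun i _ => ?_
    rcases lt_trichotomy (x i) m with h | h | h
    · simp [h, h.le, h.ne]
    · simp [h]
    · simp [h.not_ge, h.not_gt, h.ne']
  rw [h2, ← hy]
  linarith [sum_ite_eq_le_one hx m]

theorem empMedian_mem_Icc (hn : 0 < n) (hx : ∀ i, x i ∈ Icc (-b) b) :
    empMedian x ∈ Icc (-b) b := by
  have hn' : (0 : ℝ) < n := by exact_mod_cast hn
  constructor
  · by_contra h
    have h1 := half_le_countLE_empMedian (x := x) hn
    rw [countLE_eq_zero fun i => (not_le.1 h).trans_le (hx i).1] at h1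
    linarith
  · rw [empMedian_le_iff hn, countLE_eq_card fun i => (hx i).2]
    linarith

theorem sum_abs_ite_le_sub (x : Fin n → ℝ) (a c : ℝ) :
    ∑ i, |(if x i ≤ a then (1 : ℝ) else 0) - if x i ≤ c then 1 else 0| =
      |countLE x a - countLE x c| := by
  wlog hac : a ≤ c generalizing a c
  · rw [abs_sub_comm, ← this c a (not_le.1 hac).le]
    exact Finset.sum_congr rfl fun i _ => abs_sub_comm _ _
  rw [abs_sub_comm, abs_of_nonneg (sub_nonneg.2 (monotone_countLE x hac)), countLE, countLE,
    ← Finset.sum_sub_distrib]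
  refine Finset.sum_congr rfl fun i _ => ?_
  rw [abs_sub_comm, abs_of_nonneg]
  split_ifs with h1 h2 h2 <;> first | exact absurd (h2.trans hac) h1 | norm_num

/-- The indicators of `p ≤ x i` and `x i ≤ p` are complementary except when `x i = p`, which happens
for at most one `i` for each of `p = a` and `p = c`; hence the `2`. -/
theorem sum_abs_ite_ge_sub_le (hx : Function.Injective x) (a c : ℝ) :
    ∑ i, |(if a ≤ x i then (1 : ℝ) else 0) - if c ≤ x i then 1 else 0| ≤
      |countLE x a - countLE x c| + 2 := by
  rw [← sum_abs_ite_le_sub]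
  have key : ∀ i, |(if a ≤ x i then (1 : ℝ) else 0) - if c ≤ x i then 1 else 0| ≤
      |(if x i ≤ a then (1 : ℝ) else 0) - if x i ≤ c then 1 else 0| +
      ((if x i = a then (1 : ℝ) else 0) + if x i = c then 1 else 0) := by
    intro i
    have hge : ∀ p, (if p ≤ x i then (1 : ℝ) else 0) =
        1 - (if x i ≤ p then 1 else 0) + if x i = p then 1 else 0 := by
      intro p
      rcases lt_trichotomy (x i) p with h | h | h
      · simp [h.le, h.ne, h.not_ge]
      · simp [h]
      · simp [h.le, h.ne', h.not_ge]
    have hnn : ∀ p, (0 : ℝ) ≤ if x i = p then 1 else 0 := fun p => by split_ifs <;> norm_num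
    rw [hge a, hge c, abs_le]
    have h1 := neg_abs_le ((if x i ≤ a then (1 : ℝ) else 0) - if x i ≤ c then 1 else 0)
    have h2 := le_abs_self ((if x i ≤ a then (1 : ℝ) else 0) - if x i ≤ c then 1 else 0)
    constructor <;> linarith [hnn a, hnn c]
  calc _ ≤ _ := Finset.sum_le_sum fun i _ => key i
    _ ≤ _ := by
      rw [Finset.sum_add_distrib, Finset.sum_add_distrib]
      linarith [sum_ite_eq_le_one hx a, sum_ite_eq_le_one hx c]

/-- The contribution of an observation `y` to the estimator of the gradient, with an arbitrary point
`m` in place of the empirical median. -/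
def splitSum {E : Type*} [NormedAddCommGroup E] [NormedSpace ℝ E] (b : ℝ) (s : ℝ → E) (m y : ℝ) :
    E :=
  (if y ≤ m then (2 * m - y - b) • s y else 0) - (if m ≤ y then (b - y) • s y else 0)

theorem gradEstimator_eq {d : ℕ} (b : ℝ) (f : Param d → ℝ → ℝ) (θ : Param d) (x : Fin n → ℝ) :
    gradEstimator b f θ x = (n : ℝ)⁻¹ • ∑ i, splitSum b (score f θ) (empMedian x) (x i) := by
  have : (1 / 2 : ℝ) * (1 / ((n : ℝ) / 2)) = (n : ℝ)⁻¹ := by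
    rw [one_div_div, one_div_mul_eq_div, div_div_cancel_left' two_ne_zero]
  simp only [gradEstimator, this, splitSum, Finset.sum_sub_distrib, smul_sub]

section

variable {E : Type*} [NormedAddCommGroup E] [NormedSpace ℝ E] {s : ℝ → E} {C m q y : ℝ}

theorem norm_splitSum_le (hs : ∀ y, ‖s y‖ ≤ C) (hm : m ∈ Icc (-b) b) (hy : y ∈ Icc (-b) b) :
    ‖splitSum b s m y‖ ≤ 6 * b * C := by
  obtain ⟨hm1, hm2⟩ := hm
  obtain ⟨hy1, hy2⟩ := hy
  have hC : 0 ≤ C := (norm_nonneg _).trans (hs 0)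
  have hb : 0 ≤ b := by linarith
  have h1 : ‖if y ≤ m then (2 * m - y - b) • s y else 0‖ ≤ 4 * b * C := by
    split_ifs
    · rw [norm_smul, Real.norm_eq_abs]
      refine mul_le_mul (abs_le.2 ⟨?_, ?_⟩) (hs y) (norm_nonneg _) (by positivity) <;> linarith
    · rw [norm_zero]; positivity
  have h2 : ‖if m ≤ y then (b - y) • s y else 0‖ ≤ 2 * b * C := by
    split_ifs
    · rw [norm_smul, Real.norm_eq_abs]
      refine mul_le_mul (abs_le.2 ⟨?_, ?_⟩) (hs y) (norm_nonneg _) (by positivity) <;> linarith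
    · rw [norm_zero]; positivity
  calc _ ≤ _ := norm_sub_le _ _
    _ ≤ 4 * b * C + 2 * b * C := add_le_add h1 h2
    _ = _ := by ring

theorem norm_splitSum_sub_le (hs : ∀ y, ‖s y‖ ≤ C) (hq : q ∈ Icc (-b) b) (hy : y ∈ Icc (-b) b) :
    ‖splitSum b s m y - splitSum b s q y‖ ≤ 2 * C * |m - q| +
      4 * b * C * |(if y ≤ m then (1 : ℝ) else 0) - if y ≤ q then 1 else 0| +
      2 * b * C * |(if m ≤ y then (1 : ℝ) else 0) - if q ≤ y then 1 else 0| := by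
  obtain ⟨hq1, hq2⟩ := hq
  obtain ⟨hy1, hy2⟩ := hy
  have hC : 0 ≤ C := (norm_nonneg _).trans (hs 0)
  have hb : 0 ≤ b := by linarith
  set I₁ := if y ≤ m then (1 : ℝ) else 0 with hI₁
  set I₂ := if y ≤ q then (1 : ℝ) else 0 with hI₂
  set J₁ := if m ≤ y then (1 : ℝ) else 0 with hJ₁
  set J₂ := if q ≤ y then (1 : ℝ) else 0 with hJ₂
  -- The splitting pairs the indicator differences with weights free of `m`, so only `q` and `y`
  -- need to lie in `[-b, b]`.
  have heq : splitSum b s m y - splitSum b s q y =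
      (2 * (m - q) * I₁ + (2 * q - y - b) * (I₁ - I₂) - (b - y) * (J₁ - J₂)) • s y := by
    have : ∀ p, splitSum b s p y = ((2 * p - y - b) * (if y ≤ p then (1 : ℝ) else 0) -
        (b - y) * if p ≤ y then (1 : ℝ) else 0) • s y := by
      intro p
      rw [splitSum]
      split_ifs <;> module
    rw [this, this, ← sub_smul]
    congr 1
    ring
  have hI : |I₁| ≤ 1 := by rw [hI₁]; split_ifs <;> simp
  rw [heq, norm_smul, Real.norm_eq_abs]
  have h1 : |2 * (m - q) * I₁| ≤ 2 * |m - q| := by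
    rw [abs_mul, abs_mul, abs_two]
    exact mul_le_of_le_one_right (by positivity) hI
  have h2 : |(2 * q - y - b) * (I₁ - I₂)| ≤ 4 * b * |I₁ - I₂| := by
    rw [abs_mul]
    exact mul_le_mul_of_nonneg_right (abs_le.2 ⟨by linarith, by linarith⟩) (abs_nonneg _)
  have h3 : |(b - y) * (J₁ - J₂)| ≤ 2 * b * |J₁ - J₂| := by
    rw [abs_mul]
    exact mul_le_mul_of_nonneg_right (abs_le.2 ⟨by linarith, by linarith⟩) (abs_nonneg _)
  calc _ ≤ (2 * |m - q| + 4 * b * |I₁ - I₂| + 2 * b * |J₁ - J₂|) * C :=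
        mul_le_mul (((abs_sub _ _).trans (add_le_add_left (abs_add_le _ _) _)).trans
          (add_le_add (add_le_add h1 h2) h3)) (hs y) (norm_nonneg _) (by positivity)
    _ = _ := by ring

theorem norm_sum_splitSum_empMedian_sub_le (hs : ∀ y, ‖s y‖ ≤ C) (hn : 0 < n)
    (hx : ∀ i, x i ∈ Icc (-b) b) (hinj : Function.Injective x) (hq : q ∈ Icc (-b) b) :
    ‖∑ i, splitSum b s (empMedian x) (x i) - ∑ i, splitSum b s q (x i)‖ ≤
      2 * C * (n * |empMedian x - q|) + 6 * b * C * |countLE x q - n / 2| + 10 * b * C := by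
  have hC : 0 ≤ C := (norm_nonneg _).trans (hs 0)
  have hb : 0 ≤ b := by linarith [hq.1, hq.2]
  set m := empMedian x with hm
  -- The count at the empirical median lies in `[n/2, n/2 + 1]`, so the observations between `m` and
  -- `q` are controlled by the deviation of the count at the fixed point `q`.
  have hcount : |countLE x m - countLE x q| ≤ |countLE x q - n / 2| + 1 := by
    have h1 := half_le_countLE_empMedian (x := x) hn
    have h2 := countLE_empMedian_le hn hinj
    have h3 := abs_sub_le (countLE x m) (n / 2) (countLE x q)
    rw [abs_of_nonneg (sub_nonneg.2 h1), abs_sub_comm ((n : ℝ) / 2)] at h3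
    linarith
  rw [← Finset.sum_sub_distrib]
  calc _ ≤ ∑ i, (2 * C * |m - q| +
      4 * b * C * |(if x i ≤ m then (1 : ℝ) else 0) - if x i ≤ q then 1 else 0| +
      2 * b * C * |(if m ≤ x i then (1 : ℝ) else 0) - if q ≤ x i then 1 else 0|) :=
        norm_sum_le_of_le _ fun i _ => norm_splitSum_sub_le hs hq (hx i)
    _ = 2 * C * (n * |m - q|) + 4 * b * C * |countLE x m - countLE x q| +
        2 * b * C * ∑ i, |(if m ≤ x i then (1 : ℝ) else 0) - if q ≤ x i then 1 else 0| := by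
      rw [Finset.sum_add_distrib, Finset.sum_add_distrib, Finset.sum_const, Finset.card_univ,
        Fintype.card_fin, nsmul_eq_mul, ← Finset.mul_sum, ← Finset.mul_sum, sum_abs_ite_le_sub]
      ring
    _ ≤ 2 * C * (n * |m - q|) + 4 * b * C * (|countLE x q - n / 2| + 1) +
        2 * b * C * (|countLE x q - n / 2| + 1 + 2) := by
      gcongr
      exact (sum_abs_ite_ge_sub_le hinj m q).trans (by linarith)
    _ = _ := by ring

end

theorem measurable_countLE (z : ℝ) : Measurable fun x : Fin n → ℝ => countLE x z :=
  Finset.measurable_sum _ fun i _ =>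
    Measurable.ite (measurableSet_le (measurable_pi_apply i) measurable_const)
      measurable_const measurable_const

theorem measurable_empMedian : Measurable fun x : Fin n → ℝ => empMedian x := by
  rcases Nat.eq_zero_or_pos n with rfl | hn
  · exact Subsingleton.measurable
  · refine measurable_of_Iic fun z => ?_
    have : (fun x : Fin n → ℝ => empMedian x) ⁻¹' Iic z = {x | (n : ℝ) / 2 ≤ countLE x z} :=
      Set.ext fun x => empMedian_le_iff hn
    rw [this]
    exact measurableSet_le measurable_const (measurable_countLE z)

theorem measurable_gradEstimator {d : ℕ} {f : Param d → ℝ → ℝ} {θ : Param d}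
    (hs : Measurable (score f θ)) :
    Measurable fun x : Fin n → ℝ => gradEstimator b f θ x := by
  have h1 : ∀ i, Measurable fun x : Fin n → ℝ =>
      if x i ≤ empMedian x then (2 * empMedian x - x i - b) • score f θ (x i) else 0 := fun i =>
    have hm : Measurable fun x : Fin n → ℝ => 2 * empMedian x - x i - b :=
      ((measurable_empMedian.const_mul 2).sub (measurable_pi_apply i)).sub_const b
    Measurable.ite (measurableSet_le (measurable_pi_apply i) measurable_empMedian)
      (hm.smul (hs.comp (measurable_pi_apply i))) measurable_const
  have h2 : ∀ i, Measurable fun x : Fin n → ℝ =>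
      if empMedian x ≤ x i then (b - x i) • score f θ (x i) else 0 := fun i =>
    have hm : Measurable fun x : Fin n → ℝ => b - x i := measurable_const.sub (measurable_pi_apply i)
    Measurable.ite (measurableSet_le measurable_empMedian (measurable_pi_apply i))
      (hm.smul (hs.comp (measurable_pi_apply i))) measurable_const
  have h1' := (Finset.measurable_sum Finset.univ fun i _ => h1 i).const_smul
    ((1 / 2 : ℝ) * (1 / ((n : ℝ) / 2)))
  have h2' := (Finset.measurable_sum Finset.univ fun i _ => h2 i).const_smul
    ((1 / 2 : ℝ) * (1 / ((n : ℝ) / 2)))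
  exact h1'.sub h2'

end

/-! ### Probabilistic estimates for the sample -/

section

theorem ite_le_mem_Icc (y z : ℝ) : (if y ≤ z then (1 : ℝ) else 0) ∈ Icc (0 : ℝ) 1 := by
  split_ifs <;> simp

section Sample

variable {Ω : Type*} [MeasurableSpace Ω] {P : Measure Ω}
  {X : ℕ → Ω → ℝ} {μ : Measure ℝ} {n : ℕ} {b q c : ℝ}

theorem aemeasurable_sample (hlaw : ∀ k, HasLaw (X k) μ P) (n : ℕ) :
    AEMeasurable (fun ω (k : Fin n) => X k ω) P :=
  aemeasurable_pi_lambda _ fun k => (hlaw k).aemeasurable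

theorem ae_sample_mem (hlaw : ∀ k, HasLaw (X k) μ P) {s : Set ℝ} (hs : ∀ᵐ x ∂μ, x ∈ s) :
    ∀ᵐ ω ∂P, ∀ k, X k ω ∈ s := by
  refine ae_all_iff.2 fun k => ae_of_ae_map (hlaw k).aemeasurable ?_
  rwa [(hlaw k).map_eq]

theorem integral_comp_sample_ite (hlaw : ∀ k, HasLaw (X k) μ P) (z : ℝ) (k : ℕ) :
    ∫ ω, (if X k ω ≤ z then (1 : ℝ) else 0) ∂P = μ.real (Iic z) := by
  have := (hlaw k).integral_comp (f := (Iic z).indicator (1 : ℝ → ℝ))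
    ((measurable_one.indicator measurableSet_Iic).aestronglyMeasurable)
  rw [integral_indicator_one measurableSet_Iic] at this
  rw [← this]
  rfl

theorem aemeasurable_sample_ite (hlaw : ∀ k, HasLaw (X k) μ P) (z : ℝ) (k : ℕ) :
    AEMeasurable (fun ω => if X k ω ≤ z then (1 : ℝ) else 0) P :=
  (Measurable.ite measurableSet_Iic measurable_const measurable_const :
    Measurable fun y : ℝ => if y ≤ z then (1 : ℝ) else 0).comp_aemeasurable (hlaw k).aemeasurable

section SplitSum

variable {E : Type*} [NormedAddCommGroup E] [NormedSpace ℝ E] [MeasurableSpace E] [BorelSpace E]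
  [SecondCountableTopology E] {s : ℝ → E} {C : ℝ}

theorem measurable_splitSum (hs : Measurable s) (m : ℝ) : Measurable (splitSum b s m) := by
  have h1 : Measurable fun y => if y ≤ m then (2 * m - y - b) • s y else 0 :=
    have hm : Measurable fun y : ℝ => 2 * m - y - b := by fun_prop
    Measurable.ite measurableSet_Iic (hm.smul hs) measurable_const
  have h2 : Measurable fun y => if m ≤ y then (b - y) • s y else 0 :=
    have hm : Measurable fun y : ℝ => b - y := by fun_prop
    Measurable.ite measurableSet_Ici (hm.smul hs) measurable_const
  exact h1.sub h2

theorem integrable_splitSum [IsFiniteMeasure μ] (hs : Measurable s) (hC : ∀ y, ‖s y‖ ≤ C)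
    (hμ : ∀ᵐ x ∂μ, x ∈ Icc (-b) b) (hq : q ∈ Icc (-b) b) : Integrable (splitSum b s q) μ := by
  refine Integrable.of_bound (measurable_splitSum hs q).aestronglyMeasurable (6 * b * C) ?_
  filter_upwards [hμ] with y hy using norm_splitSum_le hC hq hy

theorem integral_splitSum_sample [CompleteSpace E] (hlaw : ∀ k, HasLaw (X k) μ P)
    (hs : Measurable s) (k : ℕ) :
    ∫ ω, splitSum b s q (X k ω) ∂P = ∫ y, splitSum b s q y ∂μ :=
  (hlaw k).integral_comp (measurable_splitSum hs q).aestronglyMeasurable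

theorem integrable_splitSum_sample [IsFiniteMeasure μ] (hlaw : ∀ k, HasLaw (X k) μ P)
    (hs : Measurable s) (hC : ∀ y, ‖s y‖ ≤ C)
    (hμ : ∀ᵐ x ∂μ, x ∈ Icc (-b) b) (hq : q ∈ Icc (-b) b) (k : ℕ) :
    Integrable (fun ω => splitSum b s q (X k ω)) P := by
  have := integrable_splitSum hs hC hμ hq
  rw [← (hlaw k).map_eq] at this
  exact this.comp_aemeasurable (hlaw k).aemeasurable

end SplitSum

variable [IsProbabilityMeasure P]

/-- Two independent observations have a product law, and without atoms the diagonal is null by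
Fubini. -/
theorem ae_injective_sample (hindep : iIndepFun X P) (hlaw : ∀ k, HasLaw (X k) μ P)
    (hμ : ∀ x, μ {x} = 0) : ∀ᵐ ω ∂P, Function.Injective fun k => X k ω := by
  have : IsProbabilityMeasure μ := (hlaw 0).isProbabilityMeasure_iff.1 inferInstance
  have hne : ∀ j k, j ≠ k → ∀ᵐ ω ∂P, X j ω ≠ X k ω := by
    intro j k hjk
    have hj := (hlaw j).aemeasurable
    have hk := (hlaw k).aemeasurable
    have hmap := (indepFun_iff_map_prod_eq_prod_map_map hj hk).1 (hindep.indepFun hjk)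
    rw [(hlaw j).map_eq, (hlaw k).map_eq] at hmap
    refine ae_of_ae_map (p := fun y : ℝ × ℝ => y.1 ≠ y.2) (hj.prodMk hk) ?_
    rw [hmap, ae_iff]
    have hdiag : {y : ℝ × ℝ | ¬ y.1 ≠ y.2} = diagonal ℝ := by
      ext y; simp
    rw [hdiag, Measure.prod_apply measurableSet_diagonal]
    have : ∀ x : ℝ, Prod.mk x ⁻¹' diagonal ℝ = {x} := fun x => by ext y; simp [eq_comm]
    simp [this, hμ]
  have hall : ∀ᵐ ω ∂P, ∀ j k, j ≠ k → X j ω ≠ X k ω :=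
    ae_all_iff.2 fun j => ae_all_iff.2 fun k => by
      by_cases h : j = k
      · simp [h]
      · filter_upwards [hne j k h] with ω hω _ using hω
  filter_upwards [hall] with ω hω j k hjk
  by_contra h
  exact hω j k h hjk

theorem countLE_nonneg (x : Fin n → ℝ) (z : ℝ) : 0 ≤ countLE x z :=
  Finset.sum_nonneg fun i _ => by split_ifs <;> norm_num

theorem countLE_le (x : Fin n → ℝ) (z : ℝ) : countLE x z ≤ n := by
  calc countLE x z ≤ ∑ _i : Fin n, (1 : ℝ) :=
        Finset.sum_le_sum fun i _ => by split_ifs <;> norm_num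
    _ = n := by simp

theorem memLp_countLE (hlaw : ∀ k, HasLaw (X k) μ P) (n : ℕ) (z : ℝ) :
    MemLp (fun ω => countLE (fun k : Fin n => X k ω) z) 2 P :=
  MemLp.of_bound ((measurable_countLE z).comp_aemeasurable
    (aemeasurable_sample hlaw n)).aestronglyMeasurable n
    (Eventually.of_forall fun ω => by
      rw [Real.norm_eq_abs, abs_of_nonneg (countLE_nonneg _ _)]; exact countLE_le _ _)

theorem memLp_sample_ite (hlaw : ∀ k, HasLaw (X k) μ P) (z : ℝ) (k : ℕ) :
    MemLp (fun ω => if X k ω ≤ z then (1 : ℝ) else 0) 2 P :=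
  MemLp.of_bound (aemeasurable_sample_ite hlaw z k).aestronglyMeasurable 1
    (Eventually.of_forall fun ω => by
      rw [Real.norm_eq_abs, abs_of_nonneg (ite_le_mem_Icc (X k ω) z).1]
      exact (ite_le_mem_Icc (X k ω) z).2)

theorem integral_countLE (hlaw : ∀ k, HasLaw (X k) μ P) (n : ℕ) (z : ℝ) :
    ∫ ω, countLE (fun k : Fin n => X k ω) z ∂P = n * μ.real (Iic z) := by
  simp only [countLE]
  rw [integral_finsetSum _ fun (i : Fin n) _ => (memLp_sample_ite hlaw z i).integrable one_le_two]
  simp [integral_comp_sample_ite hlaw]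

theorem variance_countLE_le (hindep : iIndepFun X P) (hlaw : ∀ k, HasLaw (X k) μ P) (n : ℕ)
    (z : ℝ) : variance (fun ω => countLE (fun k : Fin n => X k ω) z) P ≤ n := by
  have hsum : (fun ω => countLE (fun k : Fin n => X k ω) z) =
      ∑ k : Fin n, fun ω => if X k ω ≤ z then (1 : ℝ) else 0 := by
    ext ω; simp [countLE]
  have hm : Measurable fun y : ℝ => if y ≤ z then (1 : ℝ) else 0 :=
    Measurable.ite measurableSet_Iic measurable_const measurable_const
  rw [hsum, IndepFun.variance_sum (fun (k : Fin n) _ => memLp_sample_ite hlaw z k)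
    fun (j : Fin n) _ (k : Fin n) _ hjk =>
      (hindep.indepFun (i := (j : ℕ)) (j := (k : ℕ)) (Fin.val_ne_of_ne hjk)).comp hm hm]
  calc _ ≤ ∑ _k : Fin n, (1 : ℝ) := Finset.sum_le_sum fun k _ => by
        refine (variance_le_sq_of_bounded (Eventually.of_forall fun ω => ite_le_mem_Icc (X k ω) z)
          (aemeasurable_sample_ite hlaw z k)).trans ?_
        norm_num
    _ = n := by simp

theorem measureReal_countLE_deviation_le (hindep : iIndepFun X P)
    (hlaw : ∀ k, HasLaw (X k) μ P) (hn : 0 < n) (z : ℝ) {u : ℝ} (hu : 0 < u) :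
    P.real {ω | n * u ≤ |countLE (fun k : Fin n => X k ω) z - n * μ.real (Iic z)|} ≤
      1 / (n * u ^ 2) := by
  have hn' : (0 : ℝ) < n := by exact_mod_cast hn
  have h1 := meas_ge_le_variance_div_sq (memLp_countLE hlaw n z) (mul_pos hn' hu)
  rw [integral_countLE hlaw] at h1
  have h2 := ENNReal.toReal_mono ENNReal.ofReal_ne_top h1
  rw [ENNReal.toReal_ofReal (div_nonneg (variance_nonneg _ _) (sq_nonneg _))] at h2
  refine h2.trans ?_
  calc _ ≤ (n : ℝ) / (n * u) ^ 2 := by gcongr; exact variance_countLE_le hindep hlaw n z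
    _ = _ := by field_simp

theorem integral_abs_countLE_sub_le (hindep : iIndepFun X P)
    (hlaw : ∀ k, HasLaw (X k) μ P) (hn : 0 < n) (z : ℝ) :
    ∫ ω, |countLE (fun k : Fin n => X k ω) z - n * μ.real (Iic z)| ∂P ≤ √n := by
  have hn' : (0 : ℝ) < n := by exact_mod_cast hn
  have hs : 0 < √(n : ℝ) := Real.sqrt_pos.2 hn'
  have hL := memLp_countLE hlaw n z
  have hvar := variance_countLE_le hindep hlaw n z
  rw [variance_eq_integral hL.aemeasurable, integral_countLE hlaw] at hvar
  have hL' : MemLp (fun ω => countLE (fun k : Fin n => X k ω) z - n * μ.real (Iic z)) 2 P :=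
    hL.sub (memLp_const _)
  -- `|Y| ≤ Y² / (2√n) + √n / 2` by completing the square, so the variance bound `n` gives `√n`.
  calc _ ≤ ∫ ω, ((2 * √(n : ℝ))⁻¹ *
        (countLE (fun k : Fin n => X k ω) z - n * μ.real (Iic z)) ^ 2 + √n / 2) ∂P := by
        refine integral_mono (hL'.integrable one_le_two).abs
          ((hL'.integrable_sq.const_mul _).add (integrable_const _)) fun ω => ?_
        simp only
        set Y := countLE (fun k : Fin n => X k ω) z - n * μ.real (Iic z)
        have : (2 * √(n : ℝ))⁻¹ * Y ^ 2 + √n / 2 - |Y| = (2 * √(n : ℝ))⁻¹ * (|Y| - √n) ^ 2 := by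
          rw [← sq_abs Y]; field_simp; ring
        have h2 : 0 ≤ (2 * √(n : ℝ))⁻¹ * (|Y| - √n) ^ 2 := by positivity
        linarith
    _ = (2 * √(n : ℝ))⁻¹ *
        ∫ ω, (countLE (fun k : Fin n => X k ω) z - n * μ.real (Iic z)) ^ 2 ∂P + √n / 2 := by
        rw [integral_add (hL'.integrable_sq.const_mul _) (integrable_const _), integral_const_mul]
        simp
    _ ≤ (2 * √(n : ℝ))⁻¹ * n + √n / 2 := by gcongr
    _ = √n := by
        have := Real.mul_self_sqrt hn'.le
        field_simp
        linarith

theorem integrable_abs_empMedian_sub (hlaw : ∀ k, HasLaw (X k) μ P)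
    (hμ : ∀ᵐ x ∂μ, x ∈ Icc (-b) b) (hn : 0 < n) (hq : q ∈ Icc (-b) b) :
    Integrable (fun ω => |empMedian (fun k : Fin n => X k ω) - q|) P := by
  refine Integrable.of_bound (C := 2 * b) ((measurable_empMedian.comp_aemeasurable
    (aemeasurable_sample hlaw n)).sub_const q).abs.aestronglyMeasurable ?_
  filter_upwards [ae_sample_mem hlaw hμ] with ω hω
  have := empMedian_mem_Icc (x := fun k : Fin n => X k ω) hn fun i => hω i
  rw [Real.norm_eq_abs, abs_abs, abs_le]
  constructor <;> linarith [hq.1, hq.2, this.1, this.2]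

/-- If the empirical median exceeds `q + t`, fewer than `n / 2` observations are at most `q + t`,
although at least `n / 2 + n c t` are expected; symmetrically on the left. Chebyshev bounds both
events. -/
theorem measureReal_abs_empMedian_sub_le (hindep : iIndepFun X P)
    (hlaw : ∀ k, HasLaw (X k) μ P) (hn : 0 < n) (hc : 0 < c) {t : ℝ} (ht : 0 < t)
    (h₁ : c * t ≤ μ.real (Iic (q + t)) - 1 / 2) (h₂ : c * t ≤ 1 / 2 - μ.real (Iic (q - t))) :
    P.real {ω | t < |empMedian (fun k : Fin n => X k ω) - q|} ≤ 2 / c ^ 2 / (n * t ^ 2) := by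
  have hn' : (0 : ℝ) < n := by exact_mod_cast hn
  have hsub : {ω | t < |empMedian (fun k : Fin n => X k ω) - q|} ⊆
      {ω | n * (c * t) ≤ |countLE (fun k : Fin n => X k ω) (q + t) - n * μ.real (Iic (q + t))|} ∪
      {ω | n * (c * t) ≤ |countLE (fun k : Fin n => X k ω) (q - t) - n * μ.real (Iic (q - t))|} := by
    intro ω hω
    rcases lt_abs.1 (show t < |_| from hω) with h | h
    · left
      have h3 : countLE (fun k : Fin n => X k ω) (q + t) < n / 2 := by
        by_contra hh
        linarith [(empMedian_le_iff hn).2 (not_lt.1 hh)]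
      have h4 := mul_le_mul_of_nonneg_left h₁ hn'.le
      rw [mem_ofPred_eq, abs_sub_comm]
      exact le_trans (by linarith) (le_abs_self _)
    · right
      have h3 : (n : ℝ) / 2 ≤ countLE (fun k : Fin n => X k ω) (q - t) :=
        (empMedian_le_iff hn).1 (by linarith)
      have h4 := mul_le_mul_of_nonneg_left h₂ hn'.le
      rw [mem_ofPred_eq]
      exact le_trans (by linarith) (le_abs_self _)
  have hct : 0 < c * t := mul_pos hc ht
  calc _ ≤ _ := measureReal_mono hsub
    _ ≤ _ := measureReal_union_le _ _
    _ ≤ 1 / (n * (c * t) ^ 2) + 1 / (n * (c * t) ^ 2) :=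
        add_le_add (measureReal_countLE_deviation_le hindep hlaw hn _ hct)
          (measureReal_countLE_deviation_le hindep hlaw hn _ hct)
    _ = _ := by field_simp; norm_num

theorem integral_abs_empMedian_sub_le (hindep : iIndepFun X P)
    (hlaw : ∀ k, HasLaw (X k) μ P) (hμ : ∀ᵐ x ∂μ, x ∈ Icc (-b) b) (hn : 0 < n)
    (hq : q ∈ Icc (-b) b) (hc : 0 < c)
    (hgrow : ∀ t ∈ Icc 0 (2 * b), c * t ≤ μ.real (Iic (q + t)) - 1 / 2 ∧
      c * t ≤ 1 / 2 - μ.real (Iic (q - t))) :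
    ∫ ω, |empMedian (fun k : Fin n => X k ω) - q| ∂P ≤ (1 + 2 / c ^ 2) * Real.pi / √n := by
  have hn' : (0 : ℝ) < n := by exact_mod_cast hn
  have hs : 0 < √(n : ℝ) := Real.sqrt_pos.2 hn'
  have hss : √(n : ℝ) ^ 2 = n := Real.sq_sqrt hn'.le
  set A := 2 / c ^ 2 with hA
  have hA0 : 0 < A := by positivity
  -- One integrable majorant covers three regimes: probability zero beyond `2b`, the trivial bound
  -- `1` when `n t² ≤ A`, and the Chebyshev bound `A / (n t²)` otherwise.
  have htail : ∀ t ∈ Ioi (0 : ℝ), P.real {ω | t < |empMedian (fun k : Fin n => X k ω) - q|} ≤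
      (1 + A) * (1 + (√n * t) ^ 2)⁻¹ := by
    intro t ht
    have ht : 0 < t := ht
    have hnt : 0 < n * t ^ 2 := by positivity
    rw [mul_pow, hss, ← div_eq_mul_inv]
    rcases lt_or_ge (2 * b) t with hbt | hbt
    · have : P.real {ω | t < |empMedian (fun k : Fin n => X k ω) - q|} = 0 := by
        rw [measureReal_eq_zero_iff]
        refine measure_eq_zero_iff_ae_notMem.2 ?_
        filter_upwards [ae_sample_mem hlaw hμ] with ω hω
        have := empMedian_mem_Icc (x := fun k : Fin n => X k ω) hn fun i => hω i
        refine not_lt.2 (abs_le.2 ?_)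
        constructor <;> linarith [hq.1, hq.2, this.1, this.2]
      rw [this]
      positivity
    · obtain ⟨h₁, h₂⟩ := hgrow t ⟨ht.le, hbt⟩
      rcases le_total (n * t ^ 2) A with h | h
      · refine measureReal_le_one.trans ?_
        rw [one_le_div (by positivity)]
        linarith
      · refine (measureReal_abs_empMedian_sub_le hindep hlaw hn hc ht h₁ h₂).trans ?_
        rw [← hA, div_le_div_iff₀ hnt (by positivity)]
        linarith
  have hint : Integrable fun t : ℝ => (1 + A) * (1 + (√n * t) ^ 2)⁻¹ :=
    (integrable_inv_one_add_sq.comp_mul_left' hs.ne').const_mul _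
  rw [(integrable_abs_empMedian_sub hlaw hμ hn hq).integral_eq_integral_meas_lt
    (Eventually.of_forall fun ω => abs_nonneg _)]
  calc _ ≤ ∫ t in Ioi (0 : ℝ), (1 + A) * (1 + (√n * t) ^ 2)⁻¹ :=
        integral_mono_of_nonneg (Eventually.of_forall fun t => measureReal_nonneg)
          hint.integrableOn (ae_restrict_of_forall_mem measurableSet_Ioi htail)
    -- Passing to the whole line costs a factor 2 and leaves the integral of `1 / (1 + y²)`, which
    -- is `π`.
    _ ≤ ∫ t : ℝ, (1 + A) * (1 + (√n * t) ^ 2)⁻¹ :=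
        setIntegral_le_integral hint (Eventually.of_forall fun t => by positivity)
    _ = _ := by
        rw [integral_const_mul,
          Measure.integral_comp_mul_left (fun y : ℝ => (1 + y ^ 2)⁻¹), integral_univ_inv_one_add_sq,
          abs_of_pos (inv_pos.2 hs), smul_eq_mul]
        ring

theorem integrable_gradEstimator {d : ℕ} {f : Param d → ℝ → ℝ} {θ : Param d} {C : ℝ}
    (hlaw : ∀ k, HasLaw (X k) μ P) (hs : Measurable (score f θ)) (hC : ∀ y, ‖score f θ y‖ ≤ C)
    (hμ : ∀ᵐ x ∂μ, x ∈ Icc (-b) b) (n : ℕ) :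
    Integrable (fun ω => gradEstimator b f θ fun k : Fin n => X k ω) P := by
  rcases Nat.eq_zero_or_pos n with rfl | hn
  -- For an empty sample both sums are empty and the estimator is `0`.
  · simp [gradEstimator]
  refine Integrable.of_bound (C := (n : ℝ)⁻¹ * ∑ _i : Fin n, 6 * b * C)
    ((measurable_gradEstimator hs).comp_aemeasurable
      (aemeasurable_sample hlaw n)).aestronglyMeasurable ?_
  filter_upwards [ae_sample_mem hlaw hμ] with ω hω
  rw [gradEstimator_eq, norm_smul, Real.norm_eq_abs, abs_of_nonneg (by positivity)]
  refine mul_le_mul_of_nonneg_left (norm_sum_le_of_le _ fun i _ => ?_) (by positivity)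
  exact norm_splitSum_le hC (empMedian_mem_Icc hn fun i => hω i) (hω i)

theorem norm_integral_gradEstimator_sub_le {d : ℕ} {f : Param d → ℝ → ℝ} {θ : Param d} {C : ℝ}
    (hindep : iIndepFun X P)
    (hlaw : ∀ k, HasLaw (X k) μ P) (hs : Measurable (score f θ)) (hC : ∀ y, ‖score f θ y‖ ≤ C)
    (hμ : ∀ᵐ x ∂μ, x ∈ Icc (-b) b) (hatom : ∀ x, μ {x} = 0) (hn : 0 < n)
    (hq : q ∈ Icc (-b) b) (hmed : μ.real (Iic q) = 1 / 2) (hc : 0 < c)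
    (hgrow : ∀ t ∈ Icc 0 (2 * b), c * t ≤ μ.real (Iic (q + t)) - 1 / 2 ∧
      c * t ≤ 1 / 2 - μ.real (Iic (q - t))) :
    ‖(∫ ω, gradEstimator b f θ (fun k : Fin n => X k ω) ∂P) -
        ∫ y, splitSum b (score f θ) q y ∂μ‖ ≤
      (2 * C * ((1 + 2 / c ^ 2) * Real.pi) + 16 * b * C) / √n := by
  have : IsProbabilityMeasure μ := (hlaw 0).isProbabilityMeasure_iff.1 inferInstance
  have hn' : (0 : ℝ) < n := by exact_mod_cast hn
  have hs0 : 0 < √(n : ℝ) := Real.sqrt_pos.2 hn'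
  have hss : √(n : ℝ) * √n = n := Real.mul_self_sqrt hn'.le
  have hs1 : 1 ≤ √(n : ℝ) := Real.one_le_sqrt.2 (by exact_mod_cast hn)
  have hC0 : 0 ≤ C := (norm_nonneg _).trans (hC 0)
  have hb : 0 ≤ b := by linarith [hq.1, hq.2]
  have hi := integrable_splitSum_sample hlaw hs hC hμ hq
  -- With `q` in place of the empirical median the average has the target expectation for every `n`,
  -- so the bias is the expected replacement error.
  have hmean : ∫ y, splitSum b (score f θ) q y ∂μ =
      ∫ ω, (n : ℝ)⁻¹ • ∑ k : Fin n, splitSum b (score f θ) q (X k ω) ∂P := by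
    rw [integral_smul, integral_finsetSum _ fun (k : Fin n) _ => hi k]
    simp only [integral_splitSum_sample hlaw hs]
    simp [← Nat.cast_smul_eq_nsmul ℝ, smul_smul, hn'.ne']
  rw [hmean, ← integral_sub (integrable_gradEstimator hlaw hs hC hμ n)
    (by exact (integrable_finsetSum _ fun (k : Fin n) _ => hi k).smul (n : ℝ)⁻¹)]
  have hL := (memLp_countLE hlaw n q).integrable one_le_two
  have hi1 := integrable_abs_empMedian_sub hlaw hμ hn hq
  have hi2 : Integrable (fun ω => |countLE (fun k : Fin n => X k ω) q - n / 2|) P :=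
    (hL.sub (integrable_const _)).abs
  have e1 := integral_abs_empMedian_sub_le hindep hlaw hμ hn hq hc hgrow
  have e2 := integral_abs_countLE_sub_le hindep hlaw hn q
  rw [hmed, mul_one_div] at e2
  calc _ ≤ ∫ ω, (n : ℝ)⁻¹ * (2 * C * (n * |empMedian (fun k : Fin n => X k ω) - q|) +
        6 * b * C * |countLE (fun k : Fin n => X k ω) q - n / 2| + 10 * b * C) ∂P := by
        refine norm_integral_le_of_norm_le ((((hi1.const_mul _).const_mul _).add
          (hi2.const_mul _)).add (integrable_const _) |>.const_mul _) ?_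
        filter_upwards [ae_sample_mem hlaw hμ, ae_injective_sample hindep hlaw hatom] with ω hω hinj
        rw [gradEstimator_eq, ← smul_sub, norm_smul, Real.norm_eq_abs,
          abs_of_nonneg (by positivity)]
        refine mul_le_mul_of_nonneg_left ?_ (by positivity)
        exact norm_sum_splitSum_empMedian_sub_le hC hn (fun i => hω i)
          (hinj.comp Fin.val_injective) hq
    _ = (n : ℝ)⁻¹ * (2 * C * (n * ∫ ω, |empMedian (fun k : Fin n => X k ω) - q| ∂P) +
        6 * b * C * (∫ ω, |countLE (fun k : Fin n => X k ω) q - n / 2| ∂P) + 10 * b * C) := by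
        rw [integral_const_mul, integral_add
          (by exact ((hi1.const_mul _).const_mul _).add (hi2.const_mul _))
          (integrable_const _), integral_add ((hi1.const_mul _).const_mul _)
          (hi2.const_mul _), integral_const_mul, integral_const_mul, integral_const_mul]
        simp
    _ ≤ (n : ℝ)⁻¹ * (2 * C * (n * ((1 + 2 / c ^ 2) * Real.pi / √n)) +
        6 * b * C * √n + 10 * b * C * √n) := by
        -- As `√n ≥ 1`, the constant term joins the `6 * b * C * √n` term, whence `16 * b * C`.
        have : 10 * b * C ≤ 10 * b * C * √n := le_mul_of_one_le_right (by positivity) hs1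
        refine mul_le_mul_of_nonneg_left (add_le_add (add_le_add ?_ ?_) this) (by positivity)
        · gcongr
        · gcongr
    _ = _ := by
        generalize √(n : ℝ) = r at hss hs0
        rw [← hss]
        field_simp
        ring

end Sample

end

/-! ### The gradient of the mean-median deviation as an expectation -/

namespace DensityAssumption

variable {d : ℕ} {b : ℝ} {Θ : Set (Param d)} {f : Param d → ℝ → ℝ} {θ : Param d} {r C : ℝ}
  {i : Fin d}

theorem integrable_id_mul (h : DensityAssumption b Θ f) (hθ : θ ∈ Θ) :
    Integrable fun x => x * f θ x := by
  refine ((h.integrable hθ).norm.const_mul b).mono'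
    (measurable_id.mul (h.measurable hθ)).aestronglyMeasurable (Eventually.of_forall fun x => ?_)
  by_cases hx : x ∈ Icc (-b) b
  · rw [norm_mul]
    exact mul_le_mul_of_nonneg_right (abs_le.2 hx) (norm_nonneg _)
  · simp [h.eq_zero_of_notMem θ hθ x hx]

theorem hasDerivAt_MMD (h : DensityAssumption b Θ f) (hθ : θ ∈ Θ)
    (hmem : ∀ t ∈ Ioo (-r) r, θ + t • dir i ∈ Θ)
    (hfam : LogLipschitzFamily (fun t => f (θ + t • dir i)) r C)
    (hq : HasPartial (fun θ' => quantile (law f θ') (1 / 2)) θ i) :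
    HasDerivAt (fun t : ℝ => MMD (law f (θ + t • dir i)))
      (∫ x, |x - quantile (law f θ) (1 / 2)| * deriv (fun t : ℝ => f (θ + t • dir i) x) 0) 0 := by
  have key := hfam.hasDerivAt_integral_abs_sub (fun t ht => h.integrable_id_mul (hmem t ht))
    (q := fun t => quantile (law f (θ + t • dir i)) (1 / 2)) hq (by
      simp only [zero_smul, add_zero]
      rw [← h.law_real hθ measurableSet_Iic, h.law_real_Iic_quantile hθ, h.integral_eq_one θ hθ]
      norm_num)
  simp only [zero_smul, add_zero] at key
  refine key.congr_of_eventuallyEq ?_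
  filter_upwards [isOpen_Ioo.mem_nhds hfam.zero_mem] with t ht
  rw [MMD, h.integral_law (hmem t ht)]

/-- Off the null set `{q}`, the split weight is `|x - q| + (q - b)` on both sides. The constant `q -
b` contributes nothing because the total mass does not depend on the parameter. -/
theorem integral_splitSum_score_apply (h : DensityAssumption b Θ f) (hθ : θ ∈ Θ)
    (hmem : ∀ t ∈ Ioo (-r) r, θ + t • dir i ∈ Θ)
    (hfam : LogLipschitzFamily (fun t => f (θ + t • dir i)) r C) (q : ℝ) :
    ∫ y, splitSum b (score f θ) q y i ∂(law f θ) =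
      ∫ x, |x - q| * deriv (fun t : ℝ => f (θ + t • dir i) x) 0 := by
  have habs : Integrable fun x => |x - q| * f θ x := by
    refine ((h.integrable_id_mul hθ).sub ((h.integrable hθ).const_mul q)).norm.congr
      (Eventually.of_forall fun x => ?_)
    simp only [Pi.sub_apply, ← sub_mul, norm_mul, Real.norm_eq_abs,
      abs_of_nonneg (h.nonneg θ hθ x)]
  have hi1 := (hfam.hasDerivAt_integral_mul (w := fun x => |x - q|) (by fun_prop)
    (by simpa using habs)).1
  have hi2 := (hfam.hasDerivAt_integral_mul (w := fun _ => q - b) measurable_const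
    (by simpa using (h.integrable hθ).const_mul (q - b))).1
  have hzero := hfam.integral_deriv_eq_zero fun t ht => h.integral_eq_one _ (hmem t ht)
  rw [h.integral_law hθ]
  calc _ = ∫ x, (|x - q| * deriv (fun t : ℝ => f (θ + t • dir i) x) 0 +
        (q - b) * deriv (fun t : ℝ => f (θ + t • dir i) x) 0) := by
        have hne : ∀ᵐ x : ℝ, x ≠ q := by simp [ae_iff]
        refine integral_congr_ae ?_
        filter_upwards [hne] with x hx
        rw [← score_mul_density hfam, splitSum]
        rcases lt_or_gt_of_ne hx with hlt | hgt
        · rw [if_pos hlt.le, if_neg hlt.not_ge, abs_sub_comm, abs_of_pos (sub_pos.2 hlt)]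
          simp only [sub_zero, PiLp.smul_apply, smul_eq_mul]
          ring
        · rw [if_neg hgt.not_ge, if_pos hgt.le, abs_of_pos (sub_pos.2 hgt)]
          simp only [zero_sub, PiLp.neg_apply, PiLp.smul_apply, smul_eq_mul]
          ring
    _ = _ := by rw [integral_add hi1 hi2, integral_const_mul, hzero, mul_zero, add_zero]

end DensityAssumption

end MMDGrad

end

/-! ### The bias bound -/

theorem theorem2 {d : ℕ} (b : ℝ) (Θ : Set (MMDGrad.Param d)) (hΘ : IsOpen Θ)
    (f : MMDGrad.Param d → ℝ → ℝ)
    (h₁ : MMDGrad.DensityAssumption b Θ f)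
    (h₂ : MMDGrad.QuantileAssumption Θ f)
    (h₃ : MMDGrad.ScoreAssumption Θ f)
    (h₄ : MMDGrad.MedianAssumption b Θ f)
    (θ : MMDGrad.Param d) (hθ : θ ∈ Θ)
    {Ω : Type*} [MeasurableSpace Ω] (P : Measure Ω) [IsProbabilityMeasure P]
    (X : ℕ → Ω → ℝ) (hindep : iIndepFun X P)
    (hlaw : ∀ k, HasLaw (X k) (MMDGrad.law f θ) P) :
    (∀ i : Fin d, MMDGrad.HasPartial (fun θ' => MMDGrad.MMD (MMDGrad.law f θ')) θ i) ∧
    (∀ n : ℕ, Integrable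
      (fun ω => MMDGrad.gradEstimator b f θ (fun k : Fin n => X k ω)) P) ∧
    (fun n : ℕ =>
        (∫ ω, MMDGrad.gradEstimator b f θ (fun k : Fin n => X k ω) ∂P) -
          MMDGrad.grad (fun θ' => MMDGrad.MMD (MMDGrad.law f θ')) θ)
      =O[atTop] (fun n : ℕ => (n : ℝ) ^ (-(1 / 2) : ℝ)) := by
  obtain ⟨C, hC⟩ := h₃
  obtain ⟨_, hquant⟩ := h₂ (1 / 2) (by norm_num)
  choose r hmem hfam using fun i => h₁.exists_logLipschitzFamily hΘ hC hθ i
  have hderiv := fun i => h₁.hasDerivAt_MMD hθ (hmem i) (hfam i) (hquant θ hθ i).1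
  have hscore : Measurable (MMDGrad.score f θ) :=
    MMDGrad.measurable_score fun i => ⟨r i, hfam i⟩
  have hbound := MMDGrad.norm_score_le (C := C) fun i => ⟨r i, hfam i⟩
  have hae := h₁.ae_mem_Icc hθ
  have hq := Set.Ioo_subset_Icc_self (h₁.quantile_mem_Ioo hθ)
  refine ⟨fun i => (hderiv i).differentiableAt,
    MMDGrad.integrable_gradEstimator hlaw hscore hbound hae, ?_⟩
  have hprob := h₁.isProbabilityMeasure_law hθ
  -- Coordinate by coordinate, the gradient and the mean of `splitSum` at the true median are the
  -- same integral `∫ |x - q| ∂ᵢf`.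
  have hgrad : MMDGrad.grad (fun θ' => MMDGrad.MMD (MMDGrad.law f θ')) θ =
      ∫ y, MMDGrad.splitSum b (MMDGrad.score f θ)
        (MMDGrad.quantile (MMDGrad.law f θ) (1 / 2)) y ∂(MMDGrad.law f θ) := by
    ext i
    have hint := MMDGrad.integrable_splitSum hscore hbound hae hq
    rw [eval_integral_piLp (fun j => hint.eval_piLp j),
      h₁.integral_splitSum_score_apply hθ (hmem i) (hfam i)]
    exact (hderiv i).deriv
  obtain ⟨c, hc, hgrow⟩ := h₁.exists_linear_growth hθ (h₄ θ hθ).2.2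
  refine IsBigO.of_bound (2 * √(d * C ^ 2) * ((1 + 2 / c ^ 2) * Real.pi) +
    16 * b * √(d * C ^ 2)) ?_
  filter_upwards [eventually_gt_atTop 0] with n hn
  rw [hgrad, Real.norm_of_nonneg (by positivity), Real.rpow_neg n.cast_nonneg,
    ← Real.sqrt_eq_rpow, ← div_eq_mul_inv]
  exact MMDGrad.norm_integral_gradEstimator_sub_le hindep hlaw hscore hbound hae
    (fun x => MMDGrad.DensityAssumption.law_singleton x) hn hq (h₁.law_real_Iic_quantile hθ) hc
    hgrow
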